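/- Let $1\le N<L$ be integers, $\rho=N/L$, and let $\mathcal X_N(L)=\{(x_1,\dots,x_N)\in\mathbb Z^N: x_1<x_2<\cdots<x_N<x_1+L\}$. The TASEP in $\mathcal X_N(L)$ is the continuous-time Markov jump process $X(t)=(x_1(t),\dots,x_N(t))$ in which each particle jumps to the right by one with rate $1$, provided that the resulting configuration is still in $\mathcal X_N(L)$; that is, $X$ has càdlàg paths and solves the martingale problem for the generator $(\mathcal Lf)(x)=\sum_{i=1}^N \mathbf 1_{x+e_i\in\mathcal X_N(L)}\,(f(x+e_i)-f(x))$ on bounded functions $f$. Consider this process with the step initial condition $(x_1(0),\dots,x_N(0))=(-N+1,-N+2,\dots,0)$. For $z\in\mathbb C$ let $R_z=\{w\in\mathbb C: w^N(w+1)^{L-N}=z^L\}$, $R_{z,\mathrm{left}}=\{w\in R_z:\Re w<-\rho\}$, $R_{z,\mathrm{right}}=\{w\in R_z:\Re w>-\rho\}$ and $q_{z,\mathrm{right}}(w)=\prod_{v\in R_{z,\mathrm{right}}}(w-v)$. For $1\le k\le N$, $t>0$ and $a\in\mathbb Z$ put $$\mathcal C_N^{(2)}(z)=\frac{\prod_{u\in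 R_{z,\mathrm{left}}}(-u)^{k-1}\ \prod_{v\in R_{z,\mathrm{right}}}(v+1)^{-a+L-2N+k}e^{tv}}{\prod_{u\in R_{z,\mathrm{left}}}\prod_{v\in R_{z,\mathrm{right}}}(v-u)},$$ and let $K_z^{(2)}$ be the operator on the finite-dimensional space $\ell^2(R_{z,\mathrm{left}})$ with kernel $$K_z^{(2)}(u,u')=f_2(u)\sum_{v\in R_{z,\mathrm{right}}}\frac{1}{(u-v)(u'-v)f_2(v)},$$ where $$f_2(w)=\begin{cases}\dfrac{(q_{z,\mathrm{right}}(w))^2\,w^{-N-k+2}(w+1)^{-a-N+k+1}e^{tw}}{w+\rho}, & w\in R_{z,\mathrm{left}},\\[2ex] \dfrac{(q_{z,\mathrm{right}}'(w))^2\,w^{-N-k+2}(w+1)^{-a-N+k+1}e^{tw}}{w+\rho}, & w\in R_{z,\mathrm{right}}.\end{cases}$$ Then for every $k\in\{1,\dots,N\}$, $t>0$ and $a\in\mathbb Z$, $$\mathbb P(x_k(t)\ge a)=\oint \mathcal C_N^{(2)}(z)\,\det\bigl(I+K_z^{(2)}\bigr)\,\frac{dz}{2\pi \mathrm i z},$$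 where the integral (whose integrand is integrable along the contour) is over any piecewise continuously differentiable simple closed contour, oriented counterclockwise, which contains $0$ inside and lies in the annulus $0<|z|<r_0:=\rho^\rho(1-\rho)^{1-\rho}$. -/

import Mathlib

open MeasureTheory ProbabilityTheory Filter Topology
open scoped NNReal

noncomputable section

namespace PeriodicTASEP

/-! ### The process -/

/-- Membership in the configuration space
`X_N(L) = {(x_1, ..., x_N) ∈ ℤ^N : x_1 < x_2 < ... < x_N < x_1 + L}`.
Particles are indexed by `Fin N`, so that `x i` is the position of particle number `i + 1`.
For an increasing tuple the second condition is equivalent to `x_N < x_1 + L`. -/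
def IsConfig {N : ℕ} (L : ℕ) (x : Fin N → ℤ) : Prop :=
  StrictMono x ∧ ∀ i j, x j < x i + L

/-- The configuration space `X_N(L)`. -/
def Config (N L : ℕ) : Type := {x : Fin N → ℤ // IsConfig L x}

/-- `X_N(L)` is a discrete (countable) space. -/
instance (N L : ℕ) : MeasurableSpace (Config N L) := ⊤

/-- The step initial condition `(x_1, ..., x_N) = (-N + 1, -N + 2, ..., 0)`. -/
def stepConfig (N L : ℕ) (h : N < L) : Config N L :=
  ⟨fun i => -(N : ℤ) + 1 + (i : ℕ), by
    refine ⟨fun i j hij => ?_, fun i j => ?_⟩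
    · have : (i : ℕ) < (j : ℕ) := hij
      dsimp only
      omega
    · have := j.isLt
      dsimp only
      omega⟩

open Classical in
/-- The generator of TASEP in `X_N(L)`: every particle jumps to the right by one with rate `1`,
provided that the configuration after the jump still is in `X_N(L)`:
`(𝓛 f)(x) = ∑_i 1[x + e_i ∈ X_N(L)] (f (x + e_i) - f x)`. -/
def generator {N L : ℕ} (f : Config N L → ℝ) (x : Config N L) : ℝ :=
  ∑ i : Fin N,
    if h : IsConfig L (Function.update x.1 i (x.1 i + 1)) then f ⟨_, h⟩ - f x else 0

/-- `X = (X_t)_{t ≥ 0}` is a TASEP in `X_N(L)` started from the configuration `y`: an adapted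
process with right continuous paths with left limits (in the discrete space `X_N(L)`) which starts
from `y` and solves the martingale problem for the generator, that is,
`f (X_t) - f (X_0) - ∫_0^t (𝓛 f)(X_s) ds` is a martingale for every bounded `f`. -/
structure IsTASEP {N L : ℕ} {Ω : Type*} {mΩ : MeasurableSpace Ω} (μ : Measure Ω)
    (ℱ : Filtration ℝ≥0 mΩ) (X : ℝ≥0 → Ω → Config N L) (y : Config N L) : Prop where
  adapted : ∀ t, Measurable[ℱ t] (X t)
  right_continuous : ∀ ω t, ∀ᶠ s in 𝓝[>] t, X s ω = X t ω
  left_limits : ∀ ω t, ∃ x, ∀ᶠ s in 𝓝[<] t, X s ω = x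
  initial : ∀ᵐ ω ∂μ, X 0 ω = y
  martingale : ∀ f : Config N L → ℝ, (∃ C, ∀ x, |f x| ≤ C) →
    Martingale
      (fun (t : ℝ≥0) ω =>
        f (X t ω) - f (X 0 ω) - ∫ s in (0 : ℝ)..t, generator f (X s.toNNReal ω)) ℱ μ

/-! ### Bethe roots, the prefactor and the kernel -/

/-- The average density `ρ = N / L`. -/
def density (N L : ℕ) : ℝ := (N : ℝ) / L

/-- The radius `r₀ = ρ ^ ρ (1 - ρ) ^ (1 - ρ)`. -/
def criticalRadius (N L : ℕ) : ℝ :=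
  density N L ^ density N L * (1 - density N L) ^ (1 - density N L)

/-- The polynomial `q_z(w) = w ^ N (w + 1) ^ (L - N) - z ^ L` (used for `N < L`). -/
def bethePoly (N L : ℕ) (z : ℂ) : Polynomial ℂ :=
  Polynomial.X ^ N * (Polynomial.X + 1) ^ (L - N) - Polynomial.C (z ^ L)

/-- The set `R_z` of the roots of `q_z`. -/
def betheRoots (N L : ℕ) (z : ℂ) : Finset ℂ := (bethePoly N L z).roots.toFinset

theorem mem_betheRoots {N L : ℕ} (h : N < L) {z w : ℂ} :
    w ∈ betheRoots N L z ↔ w ^ N * (w + 1) ^ (L - N) - z ^ L = 0 := by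
  have hne : bethePoly N L z ≠ 0 := by
    intro h0
    have h1 : (Polynomial.X ^ N * (Polynomial.X + 1) ^ (L - N) : Polynomial ℂ)
        = Polynomial.C (z ^ L) := sub_eq_zero.mp h0
    have e : (Polynomial.X + 1 : Polynomial ℂ) = Polynomial.X + Polynomial.C 1 := by simp
    have h2 := congrArg Polynomial.natDegree h1
    rw [Polynomial.natDegree_C, Polynomial.Monic.natDegree_mul (Polynomial.monic_X_pow N)
      (by rw [e]; exact (Polynomial.monic_X_add_C 1).pow _), e,
      Polynomial.natDegree_X_pow, Polynomial.natDegree_pow, Polynomial.natDegree_X_add_C] at h2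
    omega
  rw [betheRoots, Multiset.mem_toFinset, Polynomial.mem_roots hne, Polynomial.IsRoot.def]
  simp [bethePoly]

/-- `R_{z,left}`, the roots in the half plane `Re w < -ρ`. -/
def leftRoots (N L : ℕ) (z : ℂ) : Finset ℂ :=
  (betheRoots N L z).filter fun w => w.re < -density N L

/-- `R_{z,right}`, the roots in the half plane `Re w > -ρ`. -/
def rightRoots (N L : ℕ) (z : ℂ) : Finset ℂ :=
  (betheRoots N L z).filter fun w => -density N L < w.re

/-- The monic polynomial `q_{z,right}(w) = ∏_{v ∈ R_{z,right}} (w - v)`. -/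
def rightPoly (N L : ℕ) (z : ℂ) : Polynomial ℂ :=
  ∏ v ∈ rightRoots N L z, (Polynomial.X - Polynomial.C v)

/-- The common factor `w ^ (-N-k+2) (w + 1) ^ (-a-N+k+1) e ^ (t w) / (w + ρ)` of the two branches
of `f₂`. -/
def weight (N L k : ℕ) (t : ℝ) (a : ℤ) (w : ℂ) : ℂ :=
  w ^ (-(N : ℤ) - k + 2) * (w + 1) ^ (-a - N + k + 1) * Complex.exp (t * w) / (w + density N L)

/-- The function `f₂` on `R_{z,left}`. -/
def f₂Left (N L k : ℕ) (t : ℝ) (a : ℤ) (z u : ℂ) : ℂ :=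
  (rightPoly N L z).eval u ^ 2 * weight N L k t a u

/-- The function `f₂` on `R_{z,right}`. -/
def f₂Right (N L k : ℕ) (t : ℝ) (a : ℤ) (z v : ℂ) : ℂ :=
  (rightPoly N L z).derivative.eval v ^ 2 * weight N L k t a v

/-- The prefactor `C_N^{(2)}(z)` (used for `k ≥ 1`). -/
def prefactor (N L k : ℕ) (t : ℝ) (a : ℤ) (z : ℂ) : ℂ :=
  ((∏ u ∈ leftRoots N L z, (-u) ^ (k - 1)) *
      ∏ v ∈ rightRoots N L z,
        (v + 1) ^ (-a + L - 2 * N + k : ℤ) * Complex.exp (t * v)) /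
    ∏ u ∈ leftRoots N L z, ∏ v ∈ rightRoots N L z, (v - u)

/-- The operator `K_z^{(2)}` on `ℓ²(R_{z,left})`, given by its kernel (a finite matrix)
`K(u, u') = f₂(u) ∑_{v ∈ R_{z,right}} 1 / ((u - v) (u' - v) f₂(v))`. -/
def kernelK (N L k : ℕ) (t : ℝ) (a : ℤ) (z : ℂ) :
    Matrix (leftRoots N L z) (leftRoots N L z) ℂ :=
  Matrix.of fun u u' =>
    f₂Left N L k t a z u *
      ∑ v ∈ rightRoots N L z, 1 / (((u : ℂ) - v) * ((u' : ℂ) - v) * f₂Right N L k t a z v)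

/-! ### Contours -/

/-- A simple closed contour: a piecewise continuously differentiable closed curve,
parametrized by `[0, 1]`, without self-intersections. -/
structure IsSimpleClosedContour (γ : ℝ → ℂ) : Prop where
  continuousOn : ContinuousOn γ (Set.Icc 0 1)
  closed : γ 0 = γ 1
  simple : Set.InjOn γ (Set.Ico 0 1)
  piecewise : ∃ S : Finset ℝ, ∀ a b : ℝ, 0 ≤ a → a < b → b ≤ 1 →
    (∀ s ∈ S, s ∉ Set.Ioo a b) → ContDiffOn ℝ 1 γ (Set.Icc a b)

/-- The integrand of `∮_γ F(z) dz` in the parametrization. -/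
def contourIntegrand (F : ℂ → ℂ) (γ : ℝ → ℂ) (s : ℝ) : ℂ := F (γ s) * deriv γ s

/-- The contour integral `∮_γ F(z) dz`. -/
def contourIntegral (F : ℂ → ℂ) (γ : ℝ → ℂ) : ℂ :=
  ∫ s in (0 : ℝ)..1, contourIntegrand F γ s

/-- The inside of a closed curve: the union of the bounded components of its complement. -/
def inside (γ : ℝ → ℂ) : Set ℂ :=
  {z | z ∉ γ '' Set.Icc 0 1 ∧
    Bornology.IsBounded (connectedComponentIn (γ '' Set.Icc 0 1)ᶜ z)}

/-- The contour is counterclockwise: its winding number around every point inside is `1`. -/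
def IsCounterclockwise (γ : ℝ → ℂ) : Prop :=
  ∀ z₀ ∈ inside γ,
    (2 * Real.pi * Complex.I)⁻¹ * contourIntegral (fun z => (z - z₀)⁻¹) γ = 1

end PeriodicTASEP

end

open PeriodicTASEP

/-!
The exponential series of the generator connects the process with the Bethe ansatz: iterating
Dynkin's formula (`IsTASEP.expectation_eq`) gives `P(x_k(t) ≥ a) = ∑ t^n / n! (𝓛^n f)(y)` with `f`
the indicator function of `x_k ≥ a` and `y` the initial configuration
(`IsTASEP.tendsto_expectation`).

The numbers `(𝓛^n f)(y)` are contour integrals for *every* initial configuration `y`. The function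
`det[(1 / L) ∑_{w ∈ R_z} w^(j-i+1-k) (w + 1)^(y_j-j-a+k+1) e^(tw) / (w + ρ)]` depends on `y_j`
through its `j`-th column only. Moving `y_j` by one multiplies the summand by `w + 1`, so the
determinant solves the backward equation of `N` independent particles (`betheCoeff_succ`). When a
jump is blocked, its increment has two proportional columns, where for the last particle the Bethe
equation `w^N (w + 1)^(L-N) = z^L` is used; hence the exclusion rule holds (`betheCoeff_blocked`).

At `t = 0` the entries are sums of residues over the Bethe roots, and these are Laurent polynomials
in `z^L` (`residueSum_polynomial`, `residueSum_inv_polynomial`). The contour integral against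
`dz / (2 π i z)` picks the constant term. A cyclic relabelling of the particles reduces to `k = 1`.
If `y_1 ≥ a`, the matrix is polynomial in `z^L` and unitriangular at `z = 0`; if `y_1 < a`, it is
polynomial in `z^(-L)` and its first column vanishes at `z = ∞`. So the integral is the indicator
function of `y_1 ≥ a` (`contourIntegral_betheCoeff_zero`).

For the step initial condition the matrix is `∑_{w ∈ R_z} φ(w) w^(j-i)`. There are exactly `N` right
roots (`card_rightRoots`), so Lagrange interpolation at the right roots expresses the contribution of
the left roots through that of the right roots. The determinant is therefore the one over the right
roots, which is a product of two Vandermonde determinants and gives the prefactor, times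
`det(1 + XY) = det(1 + YX)`, which is conjugate to `det(1 + K)` (`bethe_det_eq_fredholm`).
-/

noncomputable section

namespace PeriodicTASEP

/-! ### The Bethe roots in the subcritical regime -/

/-- The punctured disc `0 < |z| < r₀` of admissible spectral parameters. -/
def Subcritical (N L : ℕ) (z : ℂ) : Prop := 0 < ‖z‖ ∧ ‖z‖ < criticalRadius N L

variable {N L : ℕ} {z w : ℂ}

lemma density_pos (hN : 1 ≤ N) (hNL : N < L) : 0 < density N L := by
  unfold density
  have : 0 < L := by omega
  positivity

lemma density_lt_one (hNL : N < L) : density N L < 1 := by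
  unfold density
  have : (0 : ℝ) < L := by exact_mod_cast (by omega : 0 < L)
  rw [div_lt_one this]
  exact_mod_cast hNL

lemma criticalRadius_pos (hN : 1 ≤ N) (hNL : N < L) : 0 < criticalRadius N L :=
  mul_pos (Real.rpow_pos_of_pos (density_pos hN hNL) _)
    (Real.rpow_pos_of_pos (sub_pos.2 (density_lt_one hNL)) _)

lemma criticalRadius_le_one (hN : 1 ≤ N) (hNL : N < L) : criticalRadius N L ≤ 1 := by
  have h0 := density_pos hN hNL
  have h1 := density_lt_one hNL
  exact mul_le_one₀ (Real.rpow_le_one h0.le h1.le h0.le)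
    (Real.rpow_nonneg (by linarith) _) (Real.rpow_le_one (by linarith) (by linarith) (by linarith))

lemma criticalRadius_pow (hN : 1 ≤ N) (hNL : N < L) :
    criticalRadius N L ^ L = density N L ^ N * (1 - density N L) ^ (L - N) := by
  have h0 := density_pos hN hNL
  have h1 := density_lt_one hNL
  have hL : (L : ℝ) ≠ 0 := by exact_mod_cast (by omega : L ≠ 0)
  have e1 : density N L * L = N := by unfold density; field_simp
  have e2 : (1 - density N L) * L = (L - N : ℕ) := by
    rw [Nat.cast_sub hNL.le, sub_mul, e1, one_mul]
  rw [criticalRadius, mul_pow, ← Real.rpow_natCast, ← Real.rpow_natCast, ← Real.rpow_mul h0.le,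
    ← Real.rpow_mul (by linarith), e1, e2, Real.rpow_natCast, Real.rpow_natCast]

/-- On the critical line `Re w = -ρ` one has `|w|^N |w + 1|^(L - N) ≥ r₀^L`. -/
lemma re_ne_neg_density (hN : 1 ≤ N) (hNL : N < L) (hz : ‖z‖ < criticalRadius N L)
    (hw : w ^ N * (w + 1) ^ (L - N) = z ^ L) : w.re ≠ -density N L := by
  intro h
  have h0 := density_pos hN hNL
  have h1 := density_lt_one hNL
  have a1 : density N L ≤ ‖w‖ := by
    have := Complex.abs_re_le_norm w
    rwa [h, abs_neg, abs_of_pos h0] at this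
  have a2 : 1 - density N L ≤ ‖w + 1‖ := by
    have := Complex.abs_re_le_norm (w + 1)
    rw [Complex.add_re, Complex.one_re, h, abs_of_pos (by linarith)] at this
    linarith
  have h2 : ‖z‖ ^ L < criticalRadius N L ^ L :=
    pow_lt_pow_left₀ hz (norm_nonneg _) (by omega)
  rw [criticalRadius_pow hN hNL, ← norm_pow, ← hw, norm_mul, norm_pow, norm_pow] at h2
  have : density N L ^ N * (1 - density N L) ^ (L - N) ≤ ‖w‖ ^ N * ‖w + 1‖ ^ (L - N) := by
    gcongr
  linarith

lemma bethe_equation (hNL : N < L) (hw : w ∈ betheRoots N L z) :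
    w ^ N * (w + 1) ^ (L - N) = z ^ L :=
  sub_eq_zero.1 ((mem_betheRoots hNL).1 hw)

lemma root_ne_zero (hN : 1 ≤ N) (hNL : N < L) (hz : Subcritical N L z)
    (hw : w ∈ betheRoots N L z) : w ≠ 0 := by
  rintro rfl
  have := bethe_equation hNL hw
  rw [zero_pow (by omega), zero_mul] at this
  exact pow_ne_zero L (norm_pos_iff.1 hz.1) this.symm

lemma root_add_one_ne_zero (hNL : N < L) (hz : Subcritical N L z)
    (hw : w ∈ betheRoots N L z) : w + 1 ≠ 0 := by
  intro h
  have := bethe_equation hNL hw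
  rw [h, zero_pow (by omega), mul_zero] at this
  exact pow_ne_zero L (norm_pos_iff.1 hz.1) this.symm

lemma root_add_density_ne_zero (hN : 1 ≤ N) (hNL : N < L) (hz : Subcritical N L z)
    (hw : w ∈ betheRoots N L z) : w + density N L ≠ 0 := by
  intro h
  refine re_ne_neg_density hN hNL hz.2 (bethe_equation hNL hw) ?_
  rw [eq_neg_of_add_eq_zero_left h]
  simp

lemma bethePoly_leading (hNL : N < L) (z : ℂ) :
    (bethePoly N L z).Monic ∧ (bethePoly N L z).natDegree = L := by
  have e : (Polynomial.X + 1 : Polynomial ℂ) = Polynomial.X + Polynomial.C 1 := by simp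
  have hm : ((Polynomial.X + Polynomial.C 1 : Polynomial ℂ) ^ (L - N)).Monic :=
    (Polynomial.monic_X_add_C 1).pow _
  have hm2 : (Polynomial.X ^ N * (Polynomial.X + 1) ^ (L - N) : Polynomial ℂ).Monic := by
    rw [e]; exact (Polynomial.monic_X_pow N).mul hm
  have hd : (Polynomial.X ^ N * (Polynomial.X + 1) ^ (L - N) : Polynomial ℂ).natDegree = L := by
    rw [e, Polynomial.Monic.natDegree_mul (Polynomial.monic_X_pow N) hm,
      Polynomial.natDegree_X_pow, Polynomial.natDegree_pow, Polynomial.natDegree_X_add_C]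
    omega
  have hlt : (Polynomial.C (z ^ L)).degree <
      (Polynomial.X ^ N * (Polynomial.X + 1) ^ (L - N) : Polynomial ℂ).degree := by
    rw [Polynomial.degree_eq_natDegree hm2.ne_zero, hd]
    exact Polynomial.degree_C_le.trans_lt (by exact_mod_cast (by omega : 0 < L))
  refine ⟨hm2.sub_of_left hlt, ?_⟩
  rw [bethePoly, Polynomial.natDegree_sub_C, hd]

lemma bethePoly_derivative_eval (hN : 1 ≤ N) (hNL : N < L) (z w : ℂ) :
    (bethePoly N L z).derivative.eval w =
      L * (w + density N L) * (w ^ (N - 1) * (w + 1) ^ (L - N - 1)) := by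
  obtain ⟨n, rfl⟩ : ∃ n, N = n + 1 := ⟨N - 1, by omega⟩
  obtain ⟨m, rfl⟩ : ∃ m, L = n + 1 + (m + 1) := ⟨L - (n + 1) - 1, by omega⟩
  have h1 : n + 1 + (m + 1) - (n + 1) = m + 1 := by omega
  have hL : ((n : ℂ) + 1 + (m + 1)) ≠ 0 := by exact_mod_cast (by omega : n + 1 + (m + 1) ≠ 0)
  simp only [bethePoly, h1, density, Polynomial.derivative_sub, Polynomial.derivative_mul,
    Polynomial.derivative_pow, Polynomial.derivative_C, Polynomial.eval_sub, Polynomial.eval_add,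
    Polynomial.eval_mul, Polynomial.eval_pow, Polynomial.derivative_X, Polynomial.derivative_add,
    Polynomial.derivative_one, Polynomial.eval_C, Polynomial.eval_X, Polynomial.eval_one,
    Polynomial.eval_zero, Nat.add_sub_cancel]
  push_cast
  field_simp
  ring

lemma bethePoly_eq_nodal (hN : 1 ≤ N) (hNL : N < L) (hz : Subcritical N L z) :
    bethePoly N L z = Lagrange.nodal (betheRoots N L z) id := by
  have hne := (bethePoly_leading hNL z).1.ne_zero
  have hnd : (bethePoly N L z).roots.Nodup := by
    rw [Multiset.nodup_iff_count_le_one]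
    intro w
    rw [Polynomial.count_roots]
    by_contra! h
    rw [Polynomial.one_lt_rootMultiplicity_iff_isRoot hne] at h
    have hw : w ∈ betheRoots N L z := by
      rw [betheRoots, Multiset.mem_toFinset, Polynomial.mem_roots hne]; exact h.1
    have h2 := h.2
    rw [Polynomial.IsRoot.def, bethePoly_derivative_eval hN hNL] at h2
    have hL : (L : ℂ) ≠ 0 := by exact_mod_cast (by omega : L ≠ 0)
    exact mul_ne_zero (mul_ne_zero hL (root_add_density_ne_zero hN hNL hz hw))
      (mul_ne_zero (pow_ne_zero _ (root_ne_zero hN hNL hz hw))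
        (pow_ne_zero _ (root_add_one_ne_zero hNL hz hw))) h2
  have hs := (IsAlgClosed.splits (bethePoly N L z)).eq_prod_roots_of_monic
    (bethePoly_leading hNL z).1
  rw [hs, Lagrange.nodal_eq, Finset.prod, betheRoots, Multiset.toFinset_val, hnd.dedup]
  rfl

lemma card_betheRoots (hN : 1 ≤ N) (hNL : N < L) (hz : Subcritical N L z) :
    (betheRoots N L z).card = L := by
  rw [← Lagrange.natDegree_nodal (s := betheRoots N L z) (v := (id : ℂ → ℂ)),
    ← bethePoly_eq_nodal hN hNL hz]
  exact (bethePoly_leading hNL z).2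

lemma root_ne_left_right {u v : ℂ} (hu : u ∈ leftRoots N L z) (hv : v ∈ rightRoots N L z) :
    u ≠ v := by
  rintro rfl
  exact (Finset.mem_filter.1 hu).2.not_gt (Finset.mem_filter.1 hv).2

lemma betheRoots_eq_union (hN : 1 ≤ N) (hNL : N < L) (hz : Subcritical N L z) :
    betheRoots N L z = leftRoots N L z ∪ rightRoots N L z := by
  ext w
  simp only [leftRoots, rightRoots, Finset.mem_union, Finset.mem_filter, ← and_or_left]
  exact ⟨fun h => ⟨h, (re_ne_neg_density hN hNL hz.2 (bethe_equation hNL h)).lt_or_gt⟩,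
    fun h => h.1⟩

lemma disjoint_left_right : Disjoint (leftRoots N L z) (rightRoots N L z) :=
  Finset.disjoint_left.2 fun _ hw hw' => root_ne_left_right hw hw' rfl

lemma card_left_add_card_right (hN : 1 ≤ N) (hNL : N < L) (hz : Subcritical N L z) :
    (leftRoots N L z).card + (rightRoots N L z).card = L := by
  rw [← Finset.card_union_of_disjoint disjoint_left_right, ← betheRoots_eq_union hN hNL hz,
    card_betheRoots hN hNL hz]

/-! ### There are exactly `N` right roots -/

/-- For small `c ≠ 0` the equation `w ^ n (w + 1) ^ m = c` has at least `n` solutions near `0`: the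
function `G(w) = w (w + 1) ^ (m / n)` is locally invertible at `0`, so it takes each of the `n`
values `ξ ^ j s`, where `s ^ n = c` and `ξ` is a primitive `n`-th root of unity. -/
lemma exists_many_small_roots (n m : ℕ) (hn : 1 ≤ n) {r : ℝ} (hr : 0 < r) :
    ∃ δ > 0, ∀ c : ℂ, c ≠ 0 → ‖c‖ < δ → ∃ S : Finset ℂ, n ≤ S.card ∧
      ∀ w ∈ S, ‖w‖ < r ∧ w ^ n * (w + 1) ^ m = c := by
  set G : ℂ → ℂ := fun w => w * (w + 1) ^ ((m : ℂ) / n) with hG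
  have hder : HasStrictDerivAt G 1 0 := by
    have h1 : HasStrictDerivAt (fun w : ℂ => w + 1) 1 0 := (hasStrictDerivAt_id _).add_const _
    have h2 := h1.cpow (hasStrictDerivAt_const (0 : ℂ) ((m : ℂ) / n)) (by simp)
    have h3 := (hasStrictDerivAt_id (0 : ℂ)).mul h2
    have e : (1 : ℂ) * ((0 : ℂ) + 1) ^ ((m : ℂ) / n) + id 0 * (((m : ℂ) / n) *
        (0 + 1) ^ ((m : ℂ) / n - 1) * 1 + (0 + 1) ^ ((m : ℂ) / n) * Complex.log (0 + 1) * 0) = 1 := by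
      simp
    exact e ▸ h3
  have hmap : Filter.map G (𝓝 0) = 𝓝 (G 0) := hder.map_nhds_eq one_ne_zero
  have hG0 : G 0 = 0 := by simp [hG]
  have himg : G '' Metric.ball 0 r ∈ 𝓝 (0 : ℂ) := by
    rw [← hG0, ← hmap, hG0]
    exact Filter.image_mem_map (Metric.ball_mem_nhds _ hr)
  obtain ⟨ε, hε, hball⟩ := Metric.mem_nhds_iff.1 himg
  refine ⟨ε ^ n, pow_pos hε n, fun c hc hcε => ?_⟩
  have hn0 : (n : ℂ) ≠ 0 := by exact_mod_cast (by omega : n ≠ 0)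
  obtain ⟨s, hs⟩ := IsAlgClosed.exists_pow_nat_eq c (show 0 < n by omega)
  have hs0 : s ≠ 0 := by
    rintro rfl; rw [zero_pow (by omega)] at hs; exact hc hs.symm
  have hsε : ‖s‖ < ε := by
    rw [← hs, norm_pow] at hcε
    exact lt_of_pow_lt_pow_left₀ n hε.le hcε
  have : NeZero n := ⟨by omega⟩
  have hprim := Complex.isPrimitiveRoot_exp n (by omega)
  set ξ := Complex.exp (2 * Real.pi * Complex.I / n)
  have hξ : ‖ξ‖ = 1 := hprim.norm'_eq_one (by omega)
  have hex : ∀ j : Fin n, ∃ w ∈ Metric.ball (0 : ℂ) r, G w = ξ ^ (j : ℕ) * s := by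
    intro j
    have : ξ ^ (j : ℕ) * s ∈ Metric.ball (0 : ℂ) ε := by
      rw [mem_ball_zero_iff, norm_mul, norm_pow, hξ, one_pow, one_mul]; exact hsε
    exact hball this
  choose W hW hGW using hex
  have hinj : Function.Injective W := by
    intro i j hij
    have h := hGW i
    rw [hij, hGW j] at h
    exact Fin.ext (hprim.pow_inj i.2 j.2 (mul_right_cancel₀ hs0 h.symm))
  refine ⟨Finset.univ.image W, by rw [Finset.card_image_of_injective _ hinj]; simp, ?_⟩
  intro w hw
  obtain ⟨j, -, rfl⟩ := Finset.mem_image.1 hw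
  have hWr : ‖W j‖ < r := mem_ball_zero_iff.1 (hW j)
  refine ⟨hWr, ?_⟩
  have e1 : (W j) ^ n * (W j + 1) ^ m = G (W j) ^ n := by
    rw [hG, mul_pow, ← Complex.cpow_mul_nat, div_mul_cancel₀ _ hn0, Complex.cpow_natCast]
  rw [e1, hGW j, mul_pow, ← pow_mul, mul_comm (j : ℕ), pow_mul, hprim.pow_eq_one, one_pow, one_mul,
    hs]

/-- For small `|z|` at least `N` roots are close to `0` and at least `L - N` close to `-1`. -/
lemma card_roots_of_small (hN : 1 ≤ N) (hNL : N < L) :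
    ∃ δ > 0, ∀ z : ℂ, z ≠ 0 → ‖z‖ ^ L < δ →
      N ≤ (rightRoots N L z).card ∧ L - N ≤ (leftRoots N L z).card := by
  have h0 := density_pos hN hNL
  have h1 := density_lt_one hNL
  obtain ⟨δ₁, hδ₁, H₁⟩ := exists_many_small_roots N (L - N) hN h0
  obtain ⟨δ₂, hδ₂, H₂⟩ := exists_many_small_roots (L - N) N (by omega)
    (r := 1 - density N L) (by linarith)
  refine ⟨min δ₁ δ₂, lt_min hδ₁ hδ₂, fun z hz hzδ => ⟨?_, ?_⟩⟩
  · obtain ⟨S, hS, hS'⟩ := H₁ (z ^ L) (pow_ne_zero _ hz)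
      (by rw [norm_pow]; exact hzδ.trans_le (min_le_left _ _))
    refine hS.trans (Finset.card_le_card fun w hw => Finset.mem_filter.2 ⟨?_, ?_⟩)
    · rw [mem_betheRoots hNL, (hS' w hw).2, sub_self]
    · have := (abs_lt.1 ((Complex.abs_re_le_norm w).trans_lt (hS' w hw).1)).1
      exact this
  · obtain ⟨S, hS, hS'⟩ := H₂ ((-1) ^ L * z ^ L) (mul_ne_zero (by simp) (pow_ne_zero _ hz))
      (by rw [norm_mul, norm_pow, norm_pow, norm_neg, norm_one, one_pow, one_mul]
          exact hzδ.trans_le (min_le_right _ _))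
    -- the reflection `w ↦ -1 - w` exchanges the two ends
    rw [← Finset.card_image_of_injective S (f := fun w : ℂ => -1 - w) (sub_right_injective)] at hS
    refine hS.trans (Finset.card_le_card fun w hw => ?_)
    obtain ⟨v, hv, rfl⟩ := Finset.mem_image.1 hw
    refine Finset.mem_filter.2 ⟨?_, ?_⟩
    · rw [mem_betheRoots hNL, sub_eq_zero]
      have h := (hS' v hv).2
      have e : (-1 - v) ^ N * (-1 - v + 1) ^ (L - N) =
          (-1) ^ L * (v ^ (L - N) * (v + 1) ^ N) := by
        have e1 : (-1 - v : ℂ) = (-1) * (v + 1) := by ring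
        have e2 : (-1 - v + 1 : ℂ) = (-1) * v := by ring
        have e3 : ((-1 : ℂ)) ^ L = (-1) ^ N * (-1) ^ (L - N) := by
          rw [← pow_add]; congr 1; omega
        rw [e2, e1, mul_pow, mul_pow, e3]; ring
      rw [e, h, ← mul_assoc, ← mul_pow]; norm_num
    · have := (abs_lt.1 ((Complex.abs_re_le_norm v).trans_lt (hS' v hv).1)).1
      simp only [Complex.sub_re, Complex.neg_re, Complex.one_re]
      linarith

/-- Near a simple root the polynomial is an open map, so roots in an open set persist. -/
lemma eventually_card_roots_ge (hN : 1 ≤ N) (hNL : N < L) (hz : Subcritical N L z)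
    (U : Set ℂ) (hU : IsOpen U) (S : Finset ℂ) (hS : S ⊆ betheRoots N L z)
    (hSU : ∀ w ∈ S, w ∈ U) :
    ∀ᶠ z' in 𝓝 z, ∃ S' : Finset ℂ, S.card ≤ S'.card ∧ S' ⊆ betheRoots N L z' ∧
      ∀ w ∈ S', w ∈ U := by
  set p : ℂ → ℂ := fun w => w ^ N * (w + 1) ^ (L - N) with hp
  obtain ⟨V, hV, hVd⟩ := (S : Set ℂ).toFinite.t2_separation
  have hpd : ∀ w ∈ S, ∀ W : Set ℂ, IsOpen W → w ∈ W → ∀ᶠ z' in 𝓝 z, z' ^ L ∈ p '' W := by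
    intro w hw W hW hwW
    have hroot := hS hw
    have hder : HasStrictDerivAt p ((bethePoly N L z).derivative.eval w) w := by
      have h := (bethePoly N L z).hasStrictDerivAt w
      have h' := h.add_const (z ^ L)
      refine h'.congr_of_eventuallyEq (Eventually.of_forall fun x => ?_)
      simp [bethePoly, hp]
    have hne : (bethePoly N L z).derivative.eval w ≠ 0 := by
      rw [bethePoly_derivative_eval hN hNL]
      have hL : (L : ℂ) ≠ 0 := by exact_mod_cast (by omega : L ≠ 0)
      exact mul_ne_zero (mul_ne_zero hL (root_add_density_ne_zero hN hNL hz hroot))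
        (mul_ne_zero (pow_ne_zero _ (root_ne_zero hN hNL hz hroot))
          (pow_ne_zero _ (root_add_one_ne_zero hNL hz hroot)))
    have hmem : p '' W ∈ 𝓝 (z ^ L) := by
      rw [← bethe_equation hNL hroot]
      change p '' W ∈ 𝓝 (p w)
      rw [← hder.map_nhds_eq hne]
      exact Filter.image_mem_map (hW.mem_nhds hwW)
    exact (continuous_pow L).continuousAt.eventually_mem hmem
  have hall : ∀ᶠ z' in 𝓝 z, ∀ w ∈ S, z' ^ L ∈ p '' (V w ∩ U) := by
    rw [Filter.eventually_all_finset]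
    exact fun w hw => hpd w hw _ ((hV w).2.inter hU) ⟨(hV w).1, hSU w hw⟩
  filter_upwards [hall] with z' hz'
  choose! f hf hfp using hz'
  refine ⟨S.image f, ?_, ?_, ?_⟩
  · rw [Finset.card_image_of_injOn]
    intro w hw w' hw' h
    by_contra hne
    exact Set.disjoint_left.1 (hVd hw hw' hne) (hf w hw).1 (h ▸ (hf w' hw').1)
  · intro v hv
    obtain ⟨w, hw, rfl⟩ := Finset.mem_image.1 hv
    rw [mem_betheRoots hNL, sub_eq_zero]
    exact hfp w hw
  · intro v hv
    obtain ⟨w, hw, rfl⟩ := Finset.mem_image.1 hv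
    exact (hf w hw).2

/-- The number of right roots is locally constant in `z`: both the right and the left roots persist
under small perturbations, and their total number is `L`. -/
lemma eventually_card_rightRoots (hN : 1 ≤ N) (hNL : N < L) (hz : Subcritical N L z) :
    ∀ᶠ z' in 𝓝 z, Subcritical N L z' →
      (rightRoots N L z').card = (rightRoots N L z).card := by
  have h1 := eventually_card_roots_ge hN hNL hz {w | -density N L < w.re}
    (isOpen_lt continuous_const Complex.continuous_re) (rightRoots N L z)
    (Finset.filter_subset _ _) fun w hw => (Finset.mem_filter.1 hw).2
  have h2 := eventually_card_roots_ge hN hNL hz {w | w.re < -density N L}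
    (isOpen_lt Complex.continuous_re continuous_const) (leftRoots N L z)
    (Finset.filter_subset _ _) fun w hw => (Finset.mem_filter.1 hw).2
  filter_upwards [h1, h2] with z' ⟨S, hS, hS1, hS2⟩ ⟨T, hT, hT1, hT2⟩ hz'
  have a1 : S.card ≤ (rightRoots N L z').card :=
    Finset.card_le_card fun w hw => Finset.mem_filter.2 ⟨hS1 hw, hS2 w hw⟩
  have a2 : T.card ≤ (leftRoots N L z').card :=
    Finset.card_le_card fun w hw => Finset.mem_filter.2 ⟨hT1 hw, hT2 w hw⟩
  have a3 := card_left_add_card_right hN hNL hz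
  have a4 := card_left_add_card_right hN hNL hz'
  omega

/-- Along the ray from `0` to `z` the number of right roots is locally constant, and near `0` it is
`N`. -/
lemma card_rightRoots (hN : 1 ≤ N) (hNL : N < L) (hz : Subcritical N L z) :
    (rightRoots N L z).card = N := by
  obtain ⟨δ, hδ, H⟩ := card_roots_of_small hN hNL
  have hsub : ∀ τ ∈ Set.Ioc (0 : ℝ) 1, Subcritical N L (τ * z) := by
    intro τ hτ
    have : ‖(τ : ℂ) * z‖ = τ * ‖z‖ := by rw [norm_mul, Complex.norm_real, Real.norm_of_nonneg hτ.1.le]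
    refine ⟨by rw [this]; exact mul_pos hτ.1 hz.1, ?_⟩
    rw [this]
    exact (mul_le_of_le_one_left hz.1.le hτ.2).trans_lt hz.2
  -- the count is locally constant along the ray from `0` to `z`
  have hcont : ContinuousOn (fun τ : ℝ => (rightRoots N L (τ * z)).card) (Set.Ioc 0 1) := by
    intro τ hτ
    have h := eventually_card_rightRoots hN hNL (hsub τ hτ)
    have hc : Tendsto (fun τ : ℝ => (τ : ℂ) * z) (𝓝[Set.Ioc 0 1] τ) (𝓝 (τ * z)) :=
      (by fun_prop : Continuous fun τ : ℝ => (τ : ℂ) * z).continuousWithinAt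
    refine tendsto_nhds_of_eventually_eq ?_
    filter_upwards [hc.eventually h, self_mem_nhdsWithin] with σ h1 h2 using h1 (hsub σ h2)
  obtain ⟨τ, hτ0, hτ1, hτδ⟩ : ∃ τ : ℝ, 0 < τ ∧ τ ≤ 1 ∧ ‖(τ : ℂ) * z‖ ^ L < δ := by
    have hc : Tendsto (fun τ : ℝ => ‖(τ : ℂ) * z‖ ^ L) (𝓝[>] 0) (𝓝 0) := by
      have : Continuous fun τ : ℝ => ‖(τ : ℂ) * z‖ ^ L := by fun_prop
      have h := this.tendsto 0
      simp only [Complex.ofReal_zero, zero_mul, norm_zero, zero_pow (by omega : L ≠ 0)] at h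
      exact h.mono_left nhdsWithin_le_nhds
    obtain ⟨τ, h1, h2⟩ := ((hc.eventually_lt_const hδ).and
      (Ioc_mem_nhdsGT (zero_lt_one' ℝ))).exists
    exact ⟨τ, h2.1, h2.2, h1⟩
  have heq := isPreconnected_Ioc.constant (α := ℝ) (Y := ℕ) hcont (x := τ) (y := 1) ⟨hτ0, hτ1⟩
    ⟨one_pos, le_rfl⟩
  simp only [Complex.ofReal_one, one_mul] at heq
  have hs := hsub τ ⟨hτ0, hτ1⟩
  obtain ⟨a1, a2⟩ := H _ (norm_pos_iff.1 hs.1) hτδ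
  have a3 := card_left_add_card_right hN hNL hs
  omega

/-! ### Sums over the Bethe roots as Laurent polynomials in `z ^ L` -/

/-- The sum `∑_{w ∈ R_z} w^m (w + 1)^n / q_z'(w)` over the Bethe roots, that is, the sum of the
residues of `w^m (w + 1)^n / q_z(w)` at the zeros of `q_z`. -/
def residueSum (N L : ℕ) (m n : ℤ) (z : ℂ) : ℂ :=
  ∑ w ∈ betheRoots N L z, w ^ m * (w + 1) ^ n / (bethePoly N L z).derivative.eval w

lemma residueSum_shift (hN : 1 ≤ N) (hNL : N < L) (hz : Subcritical N L z) (m n : ℤ) :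
    residueSum N L (m + N) (n + (L - N)) z = z ^ L * residueSum N L m n z := by
  rw [residueSum, residueSum, Finset.mul_sum]
  refine Finset.sum_congr rfl fun w hw => ?_
  have e : ((L : ℤ) - N) = ((L - N : ℕ) : ℤ) := by push_cast [hNL.le]; ring
  rw [zpow_add₀ (root_ne_zero hN hNL hz hw), e, zpow_add₀ (root_add_one_ne_zero hNL hz hw),
    ← bethe_equation hNL hw, zpow_natCast, zpow_natCast]
  ring

lemma residueSum_shift_iterate (hN : 1 ≤ N) (hNL : N < L) (hz : Subcritical N L z) (m n : ℤ)
    (l : ℕ) :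
    residueSum N L (m + l * N) (n + l * (L - N)) z = (z ^ L) ^ l * residueSum N L m n z := by
  induction l with
  | zero => simp
  | succ l ih =>
    rw [pow_succ', mul_assoc, ← ih, ← residueSum_shift hN hNL hz]
    congr 1 <;> push_cast <;> ring

lemma residueSum_add_one (hN : 1 ≤ N) (hNL : N < L) (hz : Subcritical N L z) (m n : ℤ) :
    residueSum N L m (n + 1) z = residueSum N L (m + 1) n z + residueSum N L m n z := by
  rw [residueSum, residueSum, residueSum, ← Finset.sum_add_distrib]
  refine Finset.sum_congr rfl fun w hw => ?_
  rw [zpow_add_one₀ (root_ne_zero hN hNL hz hw), zpow_add_one₀ (root_add_one_ne_zero hNL hz hw)]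
  ring

/-- Lagrange interpolation: `∑ P(w) / q'(w)` is the coefficient of `w ^ (L - 1)` in `P` as soon as
`deg P < L`. -/
lemma residueSum_of_le (hN : 1 ≤ N) (hNL : N < L) (hz : Subcritical N L z) (m n : ℕ)
    (hmn : m + n ≤ L - 1) :
    residueSum N L m n z = if m + n = L - 1 then 1 else 0 := by
  have hcard := card_betheRoots hN hNL hz
  set P : Polynomial ℂ := Polynomial.X ^ m * (Polynomial.X + Polynomial.C 1) ^ n with hP
  have hm : ((Polynomial.X + Polynomial.C 1 : Polynomial ℂ) ^ n).Monic :=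
    (Polynomial.monic_X_add_C 1).pow _
  have hPm : P.Monic := (Polynomial.monic_X_pow m).mul hm
  have hd : P.natDegree = m + n := by
    rw [hP, Polynomial.Monic.natDegree_mul (Polynomial.monic_X_pow m) hm,
      Polynomial.natDegree_X_pow, Polynomial.natDegree_pow, Polynomial.natDegree_X_add_C, mul_one]
  have hlt : P.degree < (betheRoots N L z).card := by
    rw [Polynomial.degree_eq_natDegree hPm.ne_zero, hd, hcard]
    exact_mod_cast (by omega : m + n < L)
  have h := Lagrange.coeff_eq_sum (Set.injOn_id _) hlt (v := id)
  rw [hcard] at h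
  have hsum : residueSum N L m n z = P.coeff (L - 1) := by
    rw [h, residueSum]
    refine Finset.sum_congr rfl fun w hw => ?_
    congr 1
    · simp [hP]
    · rw [bethePoly_eq_nodal hN hNL hz]
      have h3 := Lagrange.eval_nodal_derivative_eval_node_eq (v := (id : ℂ → ℂ)) hw
      rw [id] at h3
      rw [h3, Lagrange.eval_nodal]
      rfl
  rw [hsum]
  split_ifs with h1
  · rw [← h1, ← hd]; exact hPm
  · exact Polynomial.coeff_eq_zero_of_natDegree_lt (by omega)

/-- For nonnegative exponents the residue sum is a polynomial in `z ^ L`. In total degree at least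
`L` the recursion `σ(m, n + 1) = σ(m + 1, n) + σ(m, n)` moves `(m, n)` along its antidiagonal into
the quadrant `N ≤ m`, `L - N ≤ n`, up to terms of lower degree, and there a factor `z ^ L` splits
off. -/
lemma residueSum_polynomial (hN : 1 ≤ N) (hNL : N < L) (m n : ℕ) :
    ∃ P : Polynomial ℂ, ∀ z, Subcritical N L z → residueSum N L m n z = P.eval (z ^ L) := by
  by_cases h0 : m + n ≤ L - 1
  · exact ⟨Polynomial.C (if m + n = L - 1 then 1 else 0), fun z hz => by
      rw [residueSum_of_le hN hNL hz m n h0, Polynomial.eval_C]⟩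
  by_cases h1 : N ≤ m ∧ L - N ≤ n
  · obtain ⟨P, hP⟩ := residueSum_polynomial hN hNL (m - N) (n - (L - N))
    refine ⟨Polynomial.X * P, fun z hz => ?_⟩
    rw [Polynomial.eval_mul, Polynomial.eval_X, ← hP z hz, ← residueSum_shift hN hNL hz]
    congr 1 <;> omega
  by_cases h2 : m < N
  · obtain ⟨P, hP⟩ := residueSum_polynomial hN hNL (m + 1) (n - 1)
    obtain ⟨Q, hQ⟩ := residueSum_polynomial hN hNL m (n - 1)
    refine ⟨P + Q, fun z hz => ?_⟩
    rw [Polynomial.eval_add, ← hP z hz, ← hQ z hz]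
    push_cast
    rw [← residueSum_add_one hN hNL hz]
    congr 1; omega
  · obtain ⟨P, hP⟩ := residueSum_polynomial hN hNL (m - 1) (n + 1)
    obtain ⟨Q, hQ⟩ := residueSum_polynomial hN hNL (m - 1) n
    refine ⟨P - Q, fun z hz => ?_⟩
    rw [Polynomial.eval_sub, ← hP z hz, ← hQ z hz]
    push_cast
    rw [residueSum_add_one hN hNL hz, add_sub_cancel_right]
    congr 1; omega
termination_by (m + n, (N - m) + (L - N - n))
decreasing_by
  all_goals simp only [Prod.lex_def]; omega

/-- Degree bound: `z ^ L` does not appear before total degree `2 L - 1`. -/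
lemma residueSum_const (hN : 1 ≤ N) (hNL : N < L) (m n : ℕ) (hmn : m + n ≤ 2 * L - 2) :
    ∃ c : ℂ, ∀ z, Subcritical N L z → residueSum N L m n z = c := by
  by_cases h0 : m + n ≤ L - 1
  · exact ⟨if m + n = L - 1 then 1 else 0, fun z hz => residueSum_of_le hN hNL hz m n h0⟩
  by_cases h1 : N ≤ m ∧ L - N ≤ n
  · refine ⟨0, fun z hz => ?_⟩
    have h := residueSum_of_le hN hNL hz (m - N) (n - (L - N)) (by omega)
    rw [if_neg (by omega)] at h
    have h2 := residueSum_shift hN hNL hz ((m - N : ℕ) : ℤ) ((n - (L - N) : ℕ) : ℤ)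
    rw [h, mul_zero] at h2
    rw [← h2]
    congr 1 <;> omega
  by_cases h2 : m < N
  · obtain ⟨P, hP⟩ := residueSum_const hN hNL (m + 1) (n - 1) (by omega)
    obtain ⟨Q, hQ⟩ := residueSum_const hN hNL m (n - 1) (by omega)
    refine ⟨P + Q, fun z hz => ?_⟩
    rw [← hP z hz, ← hQ z hz]
    push_cast
    rw [← residueSum_add_one hN hNL hz]
    congr 1; omega
  · obtain ⟨P, hP⟩ := residueSum_const hN hNL (m - 1) (n + 1) (by omega)
    obtain ⟨Q, hQ⟩ := residueSum_const hN hNL (m - 1) n (by omega)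
    refine ⟨P - Q, fun z hz => ?_⟩
    rw [← hP z hz, ← hQ z hz]
    push_cast
    rw [residueSum_add_one hN hNL hz, add_sub_cancel_right]
    congr 1; omega
termination_by (m + n, (N - m) + (L - N - n))
decreasing_by
  all_goals simp only [Prod.lex_def]; omega

lemma Subcritical.exists (hN : 1 ≤ N) (hNL : N < L) : ∃ z, Subcritical N L z := by
  obtain ⟨x, hx0, hx1⟩ := exists_between (criticalRadius_pos hN hNL)
  exact ⟨x, by rw [Subcritical, Complex.norm_real, Real.norm_of_nonneg hx0.le]; exact ⟨hx0, hx1⟩⟩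

/-- In low total degree the residue sum is a polynomial in `z ^ (-L)`, with the constant term that
corresponds to the residue at infinity. For `n < 0` the recursion lowers `m` to `0`, where a factor
`z ^ (-L)` splits off. -/
lemma residueSum_inv_polynomial (hN : 1 ≤ N) (hNL : N < L) (m : ℕ) (n : ℤ)
    (hmn : m + n ≤ 2 * L - 2) :
    ∃ P : Polynomial ℂ, (∀ z, Subcritical N L z → residueSum N L m n z = P.eval (z ^ L)⁻¹) ∧
      (m + n ≤ L - 1 → P.eval 0 = if m + n = L - 1 then 1 else 0) := by
  by_cases h0 : 0 ≤ n
  · lift n to ℕ using h0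
    obtain ⟨c, hc⟩ := residueSum_const hN hNL m n (by omega)
    refine ⟨Polynomial.C c, fun z hz => by rw [Polynomial.eval_C, hc z hz], fun h => ?_⟩
    obtain ⟨z, hz⟩ := Subcritical.exists hN hNL
    rw [Polynomial.eval_C, ← hc z hz, residueSum_of_le hN hNL hz m n (by omega)]
    congr 1
    simp only [eq_iff_iff]; omega
  by_cases h1 : m = 0
  · obtain ⟨P, hP, -⟩ := residueSum_inv_polynomial hN hNL N (n + (L - N)) (by omega)
    refine ⟨Polynomial.X * P, fun z hz => ?_, fun h => ?_⟩
    · have hzL : z ^ L ≠ 0 := pow_ne_zero _ (norm_pos_iff.1 hz.1)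
      have h := residueSum_shift hN hNL hz 0 n
      rw [zero_add] at h
      rw [Polynomial.eval_mul, Polynomial.eval_X, ← hP z hz, h, inv_mul_cancel_left₀ hzL, h1,
        Nat.cast_zero]
    · rw [Polynomial.eval_mul, Polynomial.eval_X, zero_mul, if_neg (by omega)]
  · obtain ⟨P, hP, hP0⟩ := residueSum_inv_polynomial hN hNL (m - 1) (n + 1) (by omega)
    obtain ⟨Q, hQ, hQ0⟩ := residueSum_inv_polynomial hN hNL (m - 1) n (by omega)
    refine ⟨P - Q, fun z hz => ?_, fun h => ?_⟩
    · rw [Polynomial.eval_sub, ← hP z hz, ← hQ z hz, residueSum_add_one hN hNL hz,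
        add_sub_cancel_right]
      congr 1; omega
    · have hne : ¬ ((m - 1 : ℕ) : ℤ) + n = L - 1 := by omega
      rw [Polynomial.eval_sub, hP0 (by omega), hQ0 (by omega), if_neg hne, sub_zero]
      congr 1
      simp only [eq_iff_iff]; omega
termination_by ((-n).toNat, m)
decreasing_by
  all_goals simp only [Prod.lex_def, true_and]; omega

lemma continuousOn_residueSum (hN : 1 ≤ N) (hNL : N < L) (m n : ℤ) :
    ContinuousOn (residueSum N L m n) {z | Subcritical N L z} := by
  set l : ℕ := m.natAbs + n.natAbs
  have h1 : 0 ≤ m + l * N := by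
    have : (m.natAbs : ℤ) ≤ l * N := by
      push_cast [l]; nlinarith [abs_nonneg m, abs_nonneg n]
    omega
  have h2 : 0 ≤ n + l * (L - N) := by
    have : (n.natAbs : ℤ) ≤ l * (L - N) := by
      have : (1 : ℤ) ≤ L - N := by omega
      push_cast [l]; nlinarith [abs_nonneg m, abs_nonneg n]
    omega
  obtain ⟨P, hP⟩ := residueSum_polynomial hN hNL (m + l * N).toNat (n + l * (L - N)).toNat
  have hne : ∀ z, Subcritical N L z → (z ^ L) ^ l ≠ 0 := fun z hz =>
    pow_ne_zero _ (pow_ne_zero _ (norm_pos_iff.1 hz.1))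
  have : ContinuousOn (fun z => P.eval (z ^ L) / (z ^ L) ^ l) {z | Subcritical N L z} :=
    ContinuousOn.div (by fun_prop) (by fun_prop) hne
  refine this.congr fun z hz => ?_
  beta_reduce
  rw [← hP z hz, Int.toNat_of_nonneg h1, Int.toNat_of_nonneg h2,
    residueSum_shift_iterate hN hNL hz, mul_div_cancel_left₀ _ (hne z hz)]

/-- The weight `1 / (L (w + ρ))` of the transition formulas in terms of `q_z'`. -/
lemma sum_div_density (hN : 1 ≤ N) (hNL : N < L) (hz : Subcritical N L z) (p r : ℤ) :
    ∑ w ∈ betheRoots N L z, w ^ p * (w + 1) ^ r / (L * (w + density N L)) =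
      residueSum N L (p + N - 1) (r + L - N - 1) z := by
  refine Finset.sum_congr rfl fun w hw => ?_
  have h0 := root_ne_zero hN hNL hz hw
  have h1 := root_add_one_ne_zero hNL hz hw
  have hL : (L : ℂ) ≠ 0 := by exact_mod_cast (by omega : L ≠ 0)
  have e1 : p + N - 1 = p + (N - 1 : ℕ) := by omega
  have e2 : r + L - N - 1 = r + (L - N - 1 : ℕ) := by omega
  rw [bethePoly_derivative_eval hN hNL, e1, e2, zpow_add₀ h0, zpow_add₀ h1, zpow_natCast,
    zpow_natCast]
  have h2 := root_add_density_ne_zero hN hNL hz hw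
  have h3 := pow_ne_zero (N - 1) h0
  have h4 := pow_ne_zero (L - N - 1) h1
  field_simp

/-! ### Determinants of sums and their exponential generating function -/

/-- The sum over all `N`-tuples `(w_1, …, w_N)` from the finite set `R` of
`(w_1 + ⋯ + w_N)^n det[r_i(w_j)] ∏_j c_j(w_j)`. Its exponential generating function in `n` is
`det[∑_{w ∈ R} r_i(w) c_j(w) e^{tw}]`. -/
def tupleSum (R : Finset ℂ) (r : Fin N → ℂ → ℂ) (n : ℕ) (c : Fin N → ℂ → ℂ) : ℂ :=
  ∑ w ∈ Fintype.piFinset fun _ : Fin N => R,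
    (∑ j, w j) ^ n * ((Matrix.of fun i j => r i (w j)).det * ∏ j, c j (w j))

lemma det_sum_eq_tupleSum (R : Finset ℂ) (r c : Fin N → ℂ → ℂ) :
    (Matrix.of fun i j => ∑ w ∈ R, r i w * c j w).det = tupleSum R r 0 c := by
  simp only [tupleSum, Matrix.det_apply', Matrix.of_apply, pow_zero, one_mul]
  simp_rw [Finset.sum_mul]
  rw [Finset.sum_comm]
  refine Finset.sum_congr rfl fun σ _ => ?_
  rw [Finset.prod_univ_sum, Finset.mul_sum]
  refine Finset.sum_congr rfl fun w _ => ?_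
  rw [Finset.prod_mul_distrib, mul_assoc]

lemma hasSum_tupleSum (R : Finset ℂ) (r c : Fin N → ℂ → ℂ) (t : ℂ) :
    HasSum (fun n : ℕ => t ^ n / n.factorial * tupleSum R r n c)
      (Matrix.of fun i j => ∑ w ∈ R, r i w * (c j w * Complex.exp (t * w))).det := by
  rw [det_sum_eq_tupleSum]
  simp only [tupleSum, Finset.mul_sum]
  refine hasSum_sum fun w _ => ?_
  have h : HasSum (fun n : ℕ => (t * ∑ j, w j) ^ n / n.factorial)
      (Complex.exp (t * ∑ j, w j)) := by
    have h := NormedSpace.expSeries_div_hasSum_exp (t * ∑ j, w j) (𝔸 := ℂ)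
    rwa [← Complex.exp_eq_exp_ℂ] at h
  have h2 := h.mul_right ((Matrix.of fun i j => r i (w j)).det * ∏ j, c j (w j))
  have e : (∑ j, w j) ^ 0 * ((Matrix.of fun i j => r i (w j)).det *
      ∏ j, c j (w j) * Complex.exp (t * w j)) = Complex.exp (t * ∑ j, w j) *
        ((Matrix.of fun i j => r i (w j)).det * ∏ j, c j (w j)) := by
    rw [pow_zero, one_mul, Finset.prod_mul_distrib, Finset.mul_sum, Complex.exp_sum]; ring
  rw [e]
  convert! h2 using 2 with n
  rw [mul_pow]; ring

lemma sum_tupleSum_update (R : Finset ℂ) (r c : Fin N → ℂ → ℂ) (n : ℕ) :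
    ∑ i, tupleSum R r n (Function.update c i fun w => w * c i w) = tupleSum R r (n + 1) c := by
  simp only [tupleSum]
  rw [Finset.sum_comm]
  refine Finset.sum_congr rfl fun w _ => ?_
  have h : ∀ i, ∏ j, Function.update c i (fun w => w * c i w) j (w j) =
      w i * ∏ j, c j (w j) := by
    intro i
    rw [← Finset.mul_prod_erase _ _ (Finset.mem_univ i),
      ← Finset.mul_prod_erase (a := i) _ (fun j => c j (w j)) (Finset.mem_univ i),
      Function.update_self, mul_assoc]
    congr 2
    refine Finset.prod_congr rfl fun j hj => ?_
    rw [Function.update_of_ne (Finset.ne_of_mem_erase hj)]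
  simp_rw [h]
  rw [pow_succ, ← Finset.mul_sum, ← Finset.mul_sum, ← Finset.sum_mul]
  ring

lemma tupleSum_congr (R : Finset ℂ) (r : Fin N → ℂ → ℂ) (n : ℕ) {c c' : Fin N → ℂ → ℂ}
    (h : ∀ j, ∀ w ∈ R, c j w = c' j w) : tupleSum R r n c = tupleSum R r n c' := by
  refine Finset.sum_congr rfl fun w hw => ?_
  rw [Finset.prod_congr rfl fun j _ => h j (w j) (Fintype.mem_piFinset.1 hw j)]

lemma tupleSum_update_sub (R : Finset ℂ) (r : Fin N → ℂ → ℂ) (n : ℕ) (c : Fin N → ℂ → ℂ)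
    (i : Fin N) (f g : ℂ → ℂ) :
    tupleSum R r n (Function.update c i fun w => f w - g w) =
      tupleSum R r n (Function.update c i f) - tupleSum R r n (Function.update c i g) := by
  simp only [tupleSum]
  rw [← Finset.sum_sub_distrib]
  refine Finset.sum_congr rfl fun w _ => ?_
  have h : ∀ f : ℂ → ℂ, ∏ j, Function.update c i f j (w j) =
      f (w i) * ∏ j ∈ Finset.univ.erase i, c j (w j) := by
    intro f
    rw [← Finset.mul_prod_erase _ _ (Finset.mem_univ i), Function.update_self]
    congr 1
    refine Finset.prod_congr rfl fun j hj => ?_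
    rw [Function.update_of_ne (Finset.ne_of_mem_erase hj)]
  rw [h, h, h]
  ring

/-- The sum vanishes when two of the column functions are proportional, since the determinant is
antisymmetric under an exchange of two of the variables. -/
lemma tupleSum_eq_zero (R : Finset ℂ) (r : Fin N → ℂ → ℂ) (n : ℕ) (c : Fin N → ℂ → ℂ)
    {i j : Fin N} (hij : i ≠ j) (κ : ℂ) (h : ∀ w ∈ R, c i w = κ * c j w) :
    tupleSum R r n c = 0 := by
  have key : tupleSum R r n c = - tupleSum R r n c := by
    conv_lhs => rw [tupleSum]
    rw [tupleSum, ← Finset.sum_neg_distrib]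
    refine Finset.sum_bij' (fun w _ => w ∘ Equiv.swap i j) (fun w _ => w ∘ Equiv.swap i j)
      ?_ ?_ ?_ ?_ ?_
    · intro w hw; exact Fintype.mem_piFinset.2 fun l => Fintype.mem_piFinset.1 hw _
    · intro w hw; exact Fintype.mem_piFinset.2 fun l => Fintype.mem_piFinset.1 hw _
    · intro w _; ext l; simp
    · intro w _; ext l; simp
    · intro w hw
      have e1 : ∑ l, (w ∘ Equiv.swap i j) l = ∑ l, w l := Equiv.sum_comp (Equiv.swap i j) w
      have e2 : (Matrix.of fun a b => r a ((w ∘ Equiv.swap i j) b)).det =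
          -(Matrix.of fun a b => r a (w b)).det := by
        have := Matrix.det_permute' (Equiv.swap i j) (Matrix.of fun a b => r a (w b))
        rw [Equiv.Perm.sign_swap hij] at this
        simp only [Units.val_neg, Units.val_one, Int.cast_neg, Int.cast_one, neg_mul,
          one_mul] at this
        exact this
      have e3 : ∏ l, c l ((w ∘ Equiv.swap i j) l) = ∏ l, c l (w l) := by
        have hi := Fintype.mem_piFinset.1 hw i
        have hj := Fintype.mem_piFinset.1 hw j
        rw [← Finset.mul_prod_erase _ _ (Finset.mem_univ i),
          ← Finset.mul_prod_erase (a := i) _ (fun l => c l (w l)) (Finset.mem_univ i),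
          ← Finset.mul_prod_erase (a := j) _ _ (Finset.mem_erase.2 ⟨hij.symm, Finset.mem_univ j⟩),
          ← Finset.mul_prod_erase (a := j) _ (fun l => c l (w l))
            (Finset.mem_erase.2 ⟨hij.symm, Finset.mem_univ j⟩)]
        simp only [Function.comp_apply, Equiv.swap_apply_left, Equiv.swap_apply_right]
        rw [h _ hi, h _ hj, ← mul_assoc, ← mul_assoc]
        congr 1
        · ring
        · refine Finset.prod_congr rfl fun l hl => ?_
          rw [Finset.mem_erase, Finset.mem_erase] at hl
          rw [Equiv.swap_apply_of_ne_of_ne hl.2.1 hl.1]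
      rw [e1, e2, e3]
      ring
  exact self_eq_neg.1 key

lemma norm_tupleSum_le (R : Finset ℂ) (r : Fin N → ℂ → ℂ) (n : ℕ) (c : Fin N → ℂ → ℂ)
    {A B : ℝ} {l : ℕ} (hR : R.card ≤ l) (hA : ∀ w ∈ R, ‖w‖ ≤ A)
    (hB : ∀ i j, ∀ w ∈ R, ‖r i w‖ * ‖c j w‖ ≤ B) (hA0 : 0 ≤ A)
    (hB0 : 0 ≤ B) :
    ‖tupleSum R r n c‖ ≤ (N * A) ^ n * (l ^ N * (N.factorial * B ^ N)) := by
  have hterm : ∀ w ∈ Fintype.piFinset fun _ : Fin N => R,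
      ‖(∑ j, w j) ^ n * ((Matrix.of fun i j => r i (w j)).det * ∏ j, c j (w j))‖ ≤
        (N * A) ^ n * (N.factorial * B ^ N) := by
    intro w hw
    have hw' := Fintype.mem_piFinset.1 hw
    rw [norm_mul, norm_pow]
    have h1 : ‖∑ j, w j‖ ≤ N * A := by
      refine (norm_sum_le_of_le _ fun j _ => hA _ (hw' j)).trans ?_
      simp
    have h2 : ‖(Matrix.of fun i j => r i (w j)).det * ∏ j, c j (w j)‖ ≤ N.factorial * B ^ N := by
      rw [Matrix.det_apply', Finset.sum_mul]
      refine (norm_sum_le_of_le (n := fun _ => B ^ N) _ fun σ _ => ?_).trans ?_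
      · rw [mul_assoc, ← Finset.prod_mul_distrib, norm_mul, norm_prod]
        have : ‖((Equiv.Perm.sign σ : ℤ) : ℂ)‖ = 1 := by
          rcases Int.units_eq_one_or (Equiv.Perm.sign σ) with h | h <;> simp [h]
        rw [this, one_mul]
        refine (Finset.prod_le_prod (g := fun _ => B) (fun j _ => norm_nonneg _)
          fun j _ => ?_).trans (by simp)
        rw [norm_mul]
        exact hB _ _ _ (hw' j)
      · simp [Fintype.card_perm]
    gcongr
  refine (norm_sum_le_of_le _ hterm).trans ?_
  rw [Finset.sum_const, Fintype.card_piFinset_const, nsmul_eq_mul]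
  have : ((R.card ^ N : ℕ) : ℝ) ≤ (l : ℝ) ^ N := by exact_mod_cast Nat.pow_le_pow_left hR N
  calc _ ≤ (l : ℝ) ^ N * ((N * A) ^ n * (N.factorial * B ^ N)) := by gcongr
    _ = _ := by ring

/-! ### Contour integrals of Laurent polynomials -/

section Contour
variable {γ : ℝ → ℂ}

lemma intervalIntegrable_deriv_of_contDiffOn {a b : ℝ} (hab : a < b)
    (h : ContDiffOn ℝ 1 γ (Set.Icc a b)) : IntervalIntegrable (deriv γ) volume a b := by
  have hc : ContinuousOn (derivWithin γ (Set.Icc a b)) (Set.Icc a b) :=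
    h.continuousOn_derivWithin (uniqueDiffOn_Icc hab) le_rfl
  refine (ContinuousOn.intervalIntegrable_of_Icc hab.le hc).congr_ae ?_
  rw [Set.uIoc_of_le hab.le, ← restrict_Ioo_eq_restrict_Ioc]
  refine (ae_restrict_iff' measurableSet_Ioo).2 (ae_of_all _ fun s hs => ?_)
  exact derivWithin_of_mem_nhds (Icc_mem_nhds hs.1 hs.2)

lemma IsSimpleClosedContour.intervalIntegrable_deriv (hγ : IsSimpleClosedContour γ) :
    IntervalIntegrable (deriv γ) volume 0 1 := by
  obtain ⟨S, hS⟩ := hγ.piecewise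
  have key : ∀ n : ℕ, ∀ a b : ℝ, 0 ≤ a → a < b → b ≤ 1 →
      (S.filter fun s => s ∈ Set.Ioo a b).card ≤ n → IntervalIntegrable (deriv γ) volume a b := by
    intro n
    induction n with
    | zero =>
      intro a b ha hab hb hn
      refine intervalIntegrable_deriv_of_contDiffOn hab (hS a b ha hab hb fun s hs hs' => ?_)
      rw [Nat.le_zero, Finset.card_eq_zero] at hn
      exact Finset.notMem_empty s (hn ▸ Finset.mem_filter.2 ⟨hs, hs'⟩)
    | succ n ih =>
      intro a b ha hab hb hn
      by_cases hex : ∃ s ∈ S, s ∈ Set.Ioo a b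
      · obtain ⟨s, hs, hs1, hs2⟩ := hex
        have hlt : ∀ c d, a ≤ c → d ≤ b → s ∉ Set.Ioo c d →
            (S.filter fun s => s ∈ Set.Ioo c d).card ≤ n := by
          intro c d hc hd hns
          refine Nat.le_of_lt_succ (lt_of_lt_of_le (Finset.card_lt_card ?_) hn)
          refine (Finset.ssubset_iff_of_subset fun x hx => ?_).2
            ⟨s, Finset.mem_filter.2 ⟨hs, hs1, hs2⟩, fun h => hns (Finset.mem_filter.1 h).2⟩
          have hx := Finset.mem_filter.1 hx
          exact Finset.mem_filter.2 ⟨hx.1, hc.trans_lt hx.2.1, hx.2.2.trans_le hd⟩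
        exact (ih a s ha hs1 (hs2.le.trans hb) (hlt _ _ le_rfl hs2.le fun h => lt_irrefl _ h.2)).trans
          (ih s b (ha.trans hs1.le) hs2 hb (hlt _ _ hs1.le le_rfl fun h => lt_irrefl _ h.1))
      · push Not at hex
        exact intervalIntegrable_deriv_of_contDiffOn hab (hS a b ha hab hb hex)
  exact key _ 0 1 le_rfl one_pos le_rfl le_rfl

lemma IsSimpleClosedContour.hasDerivAt (hγ : IsSimpleClosedContour γ) :
    ∃ S : Set ℝ, S.Countable ∧ ∀ s ∈ Set.Ioo (0 : ℝ) 1 \ S, HasDerivAt γ (deriv γ s) s := by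
  obtain ⟨S, hS⟩ := hγ.piecewise
  refine ⟨S, S.countable_toSet, fun s hs => ?_⟩
  have hU : Set.Ioo (0 : ℝ) 1 ∩ (S : Set ℝ)ᶜ ∈ 𝓝 s :=
    (isOpen_Ioo.inter S.finite_toSet.isClosed.isOpen_compl).mem_nhds ⟨hs.1, hs.2⟩
  obtain ⟨ε, hε, hball⟩ := Metric.mem_nhds_iff.1 hU
  have hsub : Set.Icc (s - ε / 2) (s + ε / 2) ⊆ Metric.ball s ε := by
    intro x hx
    rw [Metric.mem_ball, Real.dist_eq, abs_lt]
    constructor <;> linarith [hx.1, hx.2]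
  have h0 := (hball (hsub (Set.left_mem_Icc.2 (by linarith)))).1
  have h1 := (hball (hsub (Set.right_mem_Icc.2 (by linarith)))).1
  have hd := hS (s - ε / 2) (s + ε / 2) h0.1.le (by linarith) h1.2.le
    fun x hx hx' => (hball (hsub (Set.Ioo_subset_Icc_self hx'))).2 hx
  exact ((hd.differentiableOn one_ne_zero).differentiableAt
    (Icc_mem_nhds (by linarith) (by linarith))).hasDerivAt

lemma IsSimpleClosedContour.intervalIntegrable (hγ : IsSimpleClosedContour γ) {F : ℂ → ℂ}
    {U : Set ℂ} (hF : ContinuousOn F U) (hU : ∀ s ∈ Set.Icc (0 : ℝ) 1, γ s ∈ U) :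
    IntervalIntegrable (contourIntegrand F γ) volume 0 1 := by
  refine hγ.intervalIntegrable_deriv.continuousOn_mul ?_
  rw [Set.uIcc_of_le zero_le_one]
  exact hF.comp hγ.continuousOn hU

/-- Integer powers other than `z⁻¹` have a primitive, so their integral along a closed curve
vanishes. -/
lemma contourIntegral_zpow (hγ : IsSimpleClosedContour γ)
    (h0 : ∀ s ∈ Set.Icc (0 : ℝ) 1, γ s ≠ 0) {n : ℤ} (hn : n ≠ -1) :
    contourIntegral (fun z => z ^ n) γ = 0 := by
  obtain ⟨S, hS, hd⟩ := hγ.hasDerivAt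
  have hn1 : (n : ℂ) + 1 ≠ 0 := by
    intro h; apply hn; have : ((n + 1 : ℤ) : ℂ) = 0 := by push_cast; exact h
    have := Int.cast_eq_zero.1 this; omega
  have hint : IntervalIntegrable (contourIntegrand (fun z => z ^ n) γ) volume 0 1 :=
    hγ.intervalIntegrable (U := {0}ᶜ)
      (continuousOn_id.zpow₀ n fun z hz => Or.inl hz) h0
  have hcont : ContinuousOn (fun s => (γ s) ^ (n + 1) / ((n : ℂ) + 1)) (Set.uIcc 0 1) := by
    rw [Set.uIcc_of_le zero_le_one]
    exact (hγ.continuousOn.zpow₀ (n + 1) fun s hs => Or.inl (h0 s hs)).div_const _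
  have := integral_eq_of_hasDerivAt_off_countable (fun s => (γ s) ^ (n + 1) / ((n : ℂ) + 1))
    (contourIntegrand (fun z => z ^ n) γ) hS hcont (fun s hs => ?_) hint
  · rw [contourIntegral, this, hγ.closed, sub_self]
  · rw [min_eq_left zero_le_one, max_eq_right zero_le_one] at hs
    have h1 := (hasDerivAt_zpow (n + 1) (γ s)
      (Or.inl (h0 s (Set.Ioo_subset_Icc_self hs.1)))).comp s (hd s hs)
    have h2 := h1.div_const ((n : ℂ) + 1)
    refine h2.congr_deriv ?_
    rw [contourIntegrand]
    push_cast
    rw [add_sub_cancel_right]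
    field_simp

/-- The integral of `P(z ^ e) dz / (2 π i z)` is the constant term of `P`. -/
lemma contourIntegral_polynomial (hγ : IsSimpleClosedContour γ) (hccw : IsCounterclockwise γ)
    (hz : (0 : ℂ) ∈ inside γ) {e : ℤ} (he : e ≠ 0) (P : Polynomial ℂ) :
    contourIntegral (fun z => P.eval (z ^ e) / (2 * Real.pi * Complex.I * z)) γ = P.eval 0 := by
  have h0 : ∀ s ∈ Set.Icc (0 : ℝ) 1, γ s ≠ 0 := fun s hs h => hz.1 ⟨s, hs, h⟩
  have hU : ∀ s ∈ Set.Icc (0 : ℝ) 1, γ s ∈ ({0}ᶜ : Set ℂ) := h0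
  have hpi : (2 * Real.pi * Complex.I : ℂ) ≠ 0 := Complex.two_pi_I_ne_zero
  have hcont : ∀ P : Polynomial ℂ, ContinuousOn
      (fun z => P.eval (z ^ e) / (2 * Real.pi * Complex.I * z)) ({0}ᶜ : Set ℂ) := by
    intro P
    have h1 : ContinuousOn (fun z : ℂ => z ^ e) {0}ᶜ :=
      continuousOn_id.zpow₀ e fun z hz => Or.inl hz
    exact (P.continuous.comp_continuousOn h1).div (by fun_prop) fun z hz => mul_ne_zero hpi hz
  induction P using Polynomial.induction_on' with
  | add P Q hP hQ =>
    rw [Polynomial.eval_add, ← hP, ← hQ, contourIntegral, contourIntegral, contourIntegral,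
      ← intervalIntegral.integral_add (hγ.intervalIntegrable (hcont P) hU)
        (hγ.intervalIntegrable (hcont Q) hU)]
    refine intervalIntegral.integral_congr fun s _ => ?_
    simp only [contourIntegrand, Polynomial.eval_add]
    ring
  | monomial n a =>
    have hcongr : contourIntegral
        (fun z => (Polynomial.monomial n a).eval (z ^ e) / (2 * Real.pi * Complex.I * z)) γ =
        (2 * Real.pi * Complex.I)⁻¹ * a * contourIntegral (fun z => z ^ (e * n - 1)) γ := by
      rw [contourIntegral, contourIntegral, ← intervalIntegral.integral_const_mul]
      refine intervalIntegral.integral_congr fun s hs => ?_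
      rw [Set.uIcc_of_le zero_le_one] at hs
      have hs0 := h0 s hs
      simp only [contourIntegrand, Polynomial.eval_monomial]
      rw [zpow_sub_one₀ hs0, zpow_mul, zpow_natCast]
      field_simp
    rw [hcongr, Polynomial.eval_monomial]
    rcases Nat.eq_zero_or_pos n with rfl | hn
    · have h1 := hccw 0 hz
      simp only [sub_zero] at h1
      simp only [Nat.cast_zero, mul_zero, zero_sub, zpow_neg_one, pow_zero, mul_one]
      rw [mul_right_comm, h1, one_mul]
    · rw [contourIntegral_zpow hγ h0, mul_zero, zero_pow (by omega), mul_zero]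
      have : e * n ≠ 0 := mul_ne_zero he (by omega)
      omega

end Contour

/-! ### The Bethe ansatz solution of the backward equation -/

/-- The row functions `w^(-i+1-k) (w + 1)^(-a+k) / (L (w + ρ))` (with `i` counted from `0`). -/
def rowFun (N L k : ℕ) (a : ℤ) (i : Fin N) (w : ℂ) : ℂ :=
  w ^ (-(i : ℤ) + 1 - k) * (w + 1) ^ (-a + k) / (L * (w + density N L))

/-- The column functions `w^j (w + 1)^(y_j - j)` (with `j` counted from `0`), which carry the
dependence on the initial configuration `y`. -/
def colFun {N : ℕ} (y : Fin N → ℤ) (j : Fin N) (w : ℂ) : ℂ :=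
  w ^ (j : ℤ) * (w + 1) ^ (y j - j)

/-- The `n`-th derivative at `t = 0` of
`((-1)^(N+1) z^L)^(k-1) det[(1 / L) ∑_w w^(j-i+1-k) (w + 1)^(y_j-j-a+k) e^(tw) / (w + ρ)]`,
the integrand for `P_y(x_k(t) ≥ a)` (with `i` and `j` counted from `0`). The factor in front makes
the family compatible with the cyclic relabelling of the particles, see
`betheCoeff_rotateConfig`. -/
def betheCoeff (N L k : ℕ) (a : ℤ) (n : ℕ) (y : Fin N → ℤ) (z : ℂ) : ℂ :=
  ((-1) ^ (N + 1) * z ^ L) ^ (k - 1) *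
    tupleSum (betheRoots N L z) (rowFun N L k a) n (colFun y)

lemma colFun_update_sub (y : Fin N → ℤ) (i : Fin N) (hw : w + 1 ≠ 0) :
    colFun (Function.update y i (y i + 1)) i w - colFun y i w = w * colFun y i w := by
  simp only [colFun, Function.update_self]
  rw [show y i + 1 - (i : ℤ) = y i - i + 1 by ring, zpow_add_one₀ hw]
  ring

lemma betheCoeff_update_sub (hNL : N < L) (hz : Subcritical N L z) (k : ℕ) (a : ℤ) (n : ℕ)
    (y : Fin N → ℤ) (i : Fin N) :
    betheCoeff N L k a n (Function.update y i (y i + 1)) z - betheCoeff N L k a n y z =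
      ((-1) ^ (N + 1) * z ^ L) ^ (k - 1) * tupleSum (betheRoots N L z) (rowFun N L k a) n
        (Function.update (colFun y) i fun w => w * colFun y i w) := by
  have h1 : colFun (Function.update y i (y i + 1)) =
      Function.update (colFun y) i (colFun (Function.update y i (y i + 1)) i) := by
    funext j
    rcases eq_or_ne j i with rfl | h
    · rw [Function.update_self]
    · rw [Function.update_of_ne h]
      funext w
      simp only [colFun, Function.update_of_ne h]
  have h2 : tupleSum (betheRoots N L z) (rowFun N L k a) n (colFun y) =
      tupleSum (betheRoots N L z) (rowFun N L k a) n
        (Function.update (colFun y) i (colFun y i)) := by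
    rw [Function.update_eq_self]
  rw [betheCoeff, betheCoeff, ← mul_sub, h1, h2, ← tupleSum_update_sub]
  congr 1
  refine tupleSum_congr _ _ _ fun j w hw => ?_
  rcases eq_or_ne j i with rfl | h
  · rw [Function.update_self, Function.update_self,
      ← colFun_update_sub y j (root_add_one_ne_zero hNL hz hw)]
  · rw [Function.update_of_ne h, Function.update_of_ne h]

/-- The free evolution: without exclusion every particle jumps with rate `1`. -/
lemma betheCoeff_succ (hNL : N < L) (hz : Subcritical N L z) (k : ℕ) (a : ℤ) (n : ℕ)
    (y : Fin N → ℤ) :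
    betheCoeff N L k a (n + 1) y z = ∑ i, (betheCoeff N L k a n (Function.update y i (y i + 1)) z -
      betheCoeff N L k a n y z) := by
  simp_rw [betheCoeff_update_sub hNL hz]
  rw [← Finset.mul_sum, sum_tupleSum_update, betheCoeff]

/-- A jump is blocked by the next particle, or, for the last particle, by the periodic image of the
first one. -/
lemma blocked_cases {y : Fin N → ℤ} (hy : IsConfig L y) (i : Fin N)
    (hi : ¬ IsConfig L (Function.update y i (y i + 1))) :
    (∃ j : Fin N, (j : ℕ) = i + 1 ∧ y j = y i + 1) ∨
      ((i : ℕ) + 1 = N ∧ ∃ j : Fin N, (j : ℕ) = 0 ∧ y i + 1 = y j + L) := by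
  by_contra! hcon
  obtain ⟨h1, h2⟩ := hcon
  apply hi
  have hlt : ∀ q, i < q → y i + 1 < y q := by
    intro q hq
    have hiq : (i : ℕ) < q := hq
    have hq' : (i : ℕ) + 1 < N := by have := q.2; omega
    have a1 : y i < y ⟨i + 1, hq'⟩ := hy.1 (Fin.lt_def.2 (Nat.lt_succ_self i))
    have a2 := h1 ⟨i + 1, hq'⟩ rfl
    have a3 : y ⟨i + 1, hq'⟩ ≤ y q := hy.1.monotone (Fin.le_def.2 hiq)
    omega
  constructor
  · intro p q hpq
    rcases eq_or_ne p i with rfl | hp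
    · rw [Function.update_self, Function.update_of_ne hpq.ne']
      exact hlt q hpq
    · rw [Function.update_of_ne hp]
      have := hy.1 hpq
      rcases eq_or_ne q i with rfl | hq
      · rw [Function.update_self]; omega
      · rwa [Function.update_of_ne hq]
  · intro p q
    have hpq := hy.2 p q
    rcases eq_or_ne q p with rfl | hqp
    · have := hy.2 q q
      omega
    rcases eq_or_ne p i with rfl | hp
    · rw [Function.update_self, Function.update_of_ne hqp]; omega
    rw [Function.update_of_ne hp]
    rcases eq_or_ne q i with rfl | hqi
    · rw [Function.update_self]
      have hN : 0 < N := by have := q.2; omega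
      have a0 := hy.2 ⟨0, hN⟩ q
      have a1 : y ⟨0, hN⟩ ≤ y p := hy.1.monotone (Fin.le_def.2 (Nat.zero_le _))
      by_cases hlast : (q : ℕ) + 1 = N
      · have := h2 hlast ⟨0, hN⟩ rfl
        omega
      · have hq' : (q : ℕ) + 1 < N := by have := q.2; omega
        have a2 := hlt ⟨q + 1, hq'⟩ (Fin.lt_def.2 (Nat.lt_succ_self q))
        have a3 := hy.2 ⟨0, hN⟩ ⟨q + 1, hq'⟩
        omega
    · rwa [Function.update_of_ne hqi]

/-- The boundary condition: a forbidden jump does not change the Bethe function. -/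
lemma betheCoeff_blocked (hN : 1 ≤ N) (hNL : N < L) (hz : Subcritical N L z) (k : ℕ) (a : ℤ)
    (n : ℕ) {y : Fin N → ℤ} (hy : IsConfig L y) (i : Fin N)
    (hi : ¬ IsConfig L (Function.update y i (y i + 1))) :
    betheCoeff N L k a n (Function.update y i (y i + 1)) z = betheCoeff N L k a n y z := by
  rw [← sub_eq_zero, betheCoeff_update_sub hNL hz]
  refine mul_eq_zero_of_right _ ?_
  rcases blocked_cases hy i hi with ⟨j, hj, hyj⟩ | ⟨hiN, j, hj, hyj⟩
  · have hij : i ≠ j := by rintro rfl; omega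
    refine tupleSum_eq_zero _ _ _ _ hij 1 fun w hw => ?_
    rw [Function.update_self, Function.update_of_ne hij.symm, one_mul, colFun, colFun, hyj, hj,
      ← mul_assoc, ← zpow_one_add₀ (root_ne_zero hN hNL hz hw)]
    congr 2 <;> push_cast <;> ring
  · have hij : i ≠ j := by
      rintro rfl; omega
    refine tupleSum_eq_zero _ _ _ _ hij (z ^ L) fun w hw => ?_
    have h0 := root_ne_zero hN hNL hz hw
    have h1 := root_add_one_ne_zero hNL hz hw
    rw [Function.update_self, Function.update_of_ne hij.symm, colFun, colFun, hj,
      ← bethe_equation hNL hw, ← mul_assoc, ← zpow_one_add₀ h0,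
      show y i - (i : ℤ) = y j + (L - N : ℕ) by omega, zpow_add₀ h1,
      show (1 + (i : ℤ)) = (N : ℕ) by omega, zpow_natCast, zpow_natCast]
    simp
    ring

lemma betheCoeff_zero (hN : 1 ≤ N) (hNL : N < L) (hz : Subcritical N L z) (k : ℕ) (a : ℤ)
    (y : Fin N → ℤ) :
    betheCoeff N L k a 0 y z = ((-1) ^ (N + 1) * z ^ L) ^ (k - 1) *
      (Matrix.of fun i j : Fin N =>
        residueSum N L (j - i - k + N) (y j - j - a + k + L - N - 1) z).det := by
  rw [betheCoeff, ← det_sum_eq_tupleSum]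
  congr 3
  ext i j
  rw [show (j - i - k + N : ℤ) = (j - i + 1 - k) + N - 1 by ring, ← sum_div_density hN hNL hz]
  refine Finset.sum_congr rfl fun w hw => ?_
  have h0 := root_ne_zero hN hNL hz hw
  have h1 := root_add_one_ne_zero hNL hz hw
  rw [rowFun, colFun, show (j - i + 1 - k : ℤ) = (-(i : ℤ) + 1 - k) + j by ring, zpow_add₀ h0,
    show y j - j - a + k = (-a + k) + (y j - j) by ring, zpow_add₀ h1 (-a + k)]
  ring

lemma continuousOn_betheCoeff (hN : 1 ≤ N) (hNL : N < L) (k : ℕ) (a : ℤ) (n : ℕ)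
    (y : Fin N → ℤ) : ContinuousOn (betheCoeff N L k a n y) {z | Subcritical N L z} := by
  induction n generalizing y with
  | zero =>
    refine ContinuousOn.congr (f := fun z => ((-1) ^ (N + 1) * z ^ L) ^ (k - 1) *
      (Matrix.of fun i j : Fin N =>
        residueSum N L (j - i - k + N) (y j - j - a + k + L - N - 1) z).det) ?_
      fun z hz => betheCoeff_zero hN hNL hz k a y
    simp only [Matrix.det_apply', Matrix.of_apply]
    refine ContinuousOn.mul (by fun_prop) (continuousOn_finsetSum _ fun σ _ =>
      continuousOn_const.mul (continuousOn_finsetProd _ fun i _ =>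
        continuousOn_residueSum hN hNL _ _))
  | succ n ih =>
    refine ContinuousOn.congr (continuousOn_finsetSum Finset.univ fun i _ =>
      (ih (Function.update y i (y i + 1))).sub (ih y)) fun z hz => betheCoeff_succ hNL hz k a n y

/-! ### The initial condition -/

/-- The cyclic relabelling `(y_2, …, y_N, y_1 + L)` of the particles. -/
def rotateConfig {N : ℕ} (L : ℕ) (y : Fin N → ℤ) (j : Fin N) : ℤ :=
  if h : (j : ℕ) + 1 < N then y ⟨j + 1, h⟩ else y ⟨0, j.pos⟩ + L

lemma IsConfig.rotate {y : Fin N → ℤ} (hy : IsConfig L y) :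
    IsConfig L (rotateConfig L y) := by
  constructor
  · intro i j hij
    have hij' : (i : ℕ) < j := hij
    have hi : (i : ℕ) + 1 < N := by have := j.2; omega
    rw [rotateConfig, rotateConfig, dif_pos hi]
    split_ifs with hj
    · exact hy.1 (Fin.lt_def.2 (Nat.succ_lt_succ hij'))
    · exact hy.2 _ _
  · intro i j
    rw [rotateConfig, rotateConfig]
    split_ifs with hj hi hi
    · exact hy.2 _ _
    · have := hy.2 ⟨0, j.pos⟩ ⟨j + 1, hj⟩; omega
    · have : y ⟨0, j.pos⟩ < y ⟨i + 1, hi⟩ := hy.1 (Fin.lt_def.2 (Nat.succ_pos _))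
      omega
    · have := hy.2 ⟨0, j.pos⟩ ⟨0, j.pos⟩; omega

/-- Relabelling the particles rotates the columns of the determinant, and multiplies the column
that is moved around by `z ^ L`. -/
lemma betheCoeff_rotateConfig (hN : 1 ≤ N) (hNL : N < L) (hz : Subcritical N L z) {k : ℕ}
    (hk : 1 ≤ k) (a : ℤ) (y : Fin N → ℤ) :
    betheCoeff N L (k + 1) a 0 y z = betheCoeff N L k a 0 (rotateConfig L y) z := by
  obtain ⟨M, rfl⟩ : ∃ M, N = M + 1 := ⟨N - 1, by omega⟩
  rw [betheCoeff_zero hN hNL hz, betheCoeff_zero hN hNL hz]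
  set A : Matrix (Fin (M + 1)) (Fin (M + 1)) ℂ := Matrix.of fun i j =>
    residueSum (M + 1) L (j - i - (k + 1 : ℕ) + (M + 1 : ℕ))
      (y j - j - a + (k + 1 : ℕ) + L - (M + 1 : ℕ) - 1) z with hA
  have hcol : (Matrix.of fun i j : Fin (M + 1) =>
      residueSum (M + 1) L (j - i - k + (M + 1 : ℕ))
        (rotateConfig L y j - j - a + k + L - (M + 1 : ℕ) - 1) z) =
      Matrix.of fun i j => (if j = Fin.last M then z ^ L else 1) *
        A.submatrix id (finRotate (M + 1)) i j := by
    ext i j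
    simp only [Matrix.of_apply, Matrix.submatrix_apply, id, hA]
    split_ifs with hj
    · subst hj
      have e : finRotate (M + 1) (Fin.last M) = 0 := finRotate_last
      have e0 : rotateConfig L y (Fin.last M) = y 0 + L := dif_neg (by simp)
      rw [e, ← residueSum_shift hN hNL hz, e0]
      congr 1 <;> simp only [Fin.val_last, Fin.val_zero] <;> push_cast <;> ring
    · have hlt : (j : ℕ) < M := by
        have := j.2
        have h : (j : ℕ) ≠ M := fun h => hj (Fin.ext h)
        omega
      have e : finRotate (M + 1) j = ⟨j + 1, by omega⟩ := finRotate_of_lt hlt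
      have e0 : rotateConfig L y j = y ⟨j + 1, by omega⟩ := dif_pos (by omega)
      rw [e, one_mul, e0]
      congr 1 <;> push_cast <;> ring
  rw [hcol, Matrix.det_mul_row, Matrix.det_permute', sign_finRotate]
  have e1 : ∏ j : Fin (M + 1), (if j = Fin.last M then z ^ L else 1) = z ^ L := by
    rw [Finset.prod_ite_eq' Finset.univ (Fin.last M)]; simp
  obtain ⟨l, rfl⟩ : ∃ l, k = l + 1 := ⟨k - 1, by omega⟩
  rw [e1]
  simp only [Nat.add_sub_cancel, pow_succ _ l, pow_succ _ (M + 1), pow_succ _ M]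
  push_cast
  ring

lemma residueSum_upper (hN : 1 ≤ N) (hNL : N < L) {m n : ℕ} (hm : N ≤ m) (hn : L - N ≤ n) :
    ∃ P : Polynomial ℂ, (∀ z, Subcritical N L z → residueSum N L m n z = P.eval (z ^ L)) ∧
      P.eval 0 = 0 := by
  obtain ⟨P, hP⟩ := residueSum_polynomial hN hNL (m - N) (n - (L - N))
  refine ⟨Polynomial.X * P, fun z hz => ?_, by simp⟩
  rw [Polynomial.eval_mul, Polynomial.eval_X, ← hP z hz, ← residueSum_shift hN hNL hz]
  congr 1 <;> omega

lemma residueSum_diagonal (hN : 1 ≤ N) (hNL : N < L) {n : ℕ} (hn : L - N ≤ n) :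
    ∃ P : Polynomial ℂ,
      (∀ z, Subcritical N L z → residueSum N L (N - 1 : ℕ) n z = P.eval (z ^ L)) ∧
      P.eval 0 = 1 := by
  induction n, hn using Nat.le_induction with
  | base =>
    refine ⟨1, fun z hz => ?_, by simp⟩
    rw [residueSum_of_le hN hNL hz _ _ (by omega), if_pos (by omega), Polynomial.eval_one]
  | succ n hn ih =>
    obtain ⟨P, hP, hP0⟩ := ih
    obtain ⟨Q, hQ, hQ0⟩ := residueSum_upper hN hNL le_rfl hn
    refine ⟨Q + P, fun z hz => ?_, by rw [Polynomial.eval_add, hP0, hQ0, zero_add]⟩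
    rw [Polynomial.eval_add, ← hP z hz, ← hQ z hz]
    push_cast
    rw [residueSum_add_one hN hNL hz]
    congr 2; omega

lemma eval_det {n : Type*} [Fintype n] [DecidableEq n] (P : Matrix n n (Polynomial ℂ)) (x : ℂ) :
    P.det.eval x = (Matrix.of fun i j => (P i j).eval x).det :=
  RingHom.map_det (Polynomial.evalRingHom x) P

/-- If the first particle starts at or to the right of `a`, the matrix is polynomial in `z ^ L` and
unitriangular at `z = 0`. -/
lemma betheCoeff_of_le (hN : 1 ≤ N) (hNL : N < L) {y : Fin N → ℤ} (hy : IsConfig L y) {a : ℤ}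
    (ha : a ≤ y ⟨0, hN⟩) :
    ∃ P : Polynomial ℂ, (∀ z, Subcritical N L z → betheCoeff N L 1 a 0 y z = P.eval (z ^ L)) ∧
      P.eval 0 = 1 := by
  have hyj : ∀ (n : ℕ) (h : n < N), a + n ≤ y ⟨n, h⟩ := by
    intro n
    induction n with
    | zero => intro h; simpa using ha
    | succ n ih =>
      intro h
      have h1 := ih (by omega)
      have h2 : y ⟨n, by omega⟩ < y ⟨n + 1, h⟩ := hy.1 (Fin.lt_def.2 (Nat.lt_succ_self n))
      push_cast
      omega
  have hex : ∀ i j : Fin N, ∃ P : Polynomial ℂ, (∀ z, Subcritical N L z →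
      residueSum N L (j - i - (1 : ℕ) + N) (y j - j - a + (1 : ℕ) + L - N - 1) z =
        P.eval (z ^ L)) ∧ (i < j → P.eval 0 = 0) ∧ (i = j → P.eval 0 = 1) := by
    intro i j
    have h : a + (j : ℕ) ≤ y j := hyj j j.2
    obtain ⟨m, hm⟩ := Int.eq_ofNat_of_zero_le
      (show 0 ≤ ((j : ℕ) : ℤ) - (i : ℕ) - (1 : ℕ) + N by have := i.2; omega)
    obtain ⟨n, hn⟩ := Int.eq_ofNat_of_zero_le
      (show 0 ≤ y j - (j : ℕ) - a + (1 : ℕ) + L - N - 1 by omega)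
    rw [hm, hn]
    rcases lt_trichotomy (i : ℕ) j with hij | hij | hij
    · obtain ⟨P, hP, hP0⟩ := residueSum_upper hN hNL (m := m) (n := n) (by omega) (by omega)
      exact ⟨P, hP, fun _ => hP0, fun h => absurd (congrArg Fin.val h) hij.ne⟩
    · have : m = N - 1 := by omega
      subst this
      obtain ⟨P, hP, hP0⟩ := residueSum_diagonal hN hNL (n := n) (by omega)
      exact ⟨P, hP, fun h => absurd hij (Fin.lt_def.1 h).ne, fun _ => hP0⟩
    · obtain ⟨P, hP⟩ := residueSum_polynomial hN hNL m n
      exact ⟨P, hP, fun h => absurd (Fin.lt_def.1 h) hij.not_gt,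
        fun h => absurd (congrArg Fin.val h) hij.ne'⟩
  choose P hP hP0 hP1 using hex
  refine ⟨(Matrix.of P).det, fun z hz => ?_, ?_⟩
  · rw [betheCoeff_zero hN hNL hz, eval_det, Nat.sub_self, pow_zero, one_mul]
    congr 2
    ext i j
    exact hP i j z hz
  · rw [eval_det, Matrix.det_of_isLowerTriangular]
    · exact Finset.prod_eq_one fun i _ => hP1 i i rfl
    · intro i j hij
      exact hP0 i j hij

/-- If the first particle starts to the left of `a`, the matrix is polynomial in `z ^ (-L)`, and its
first column has no constant term. -/
lemma betheCoeff_of_lt (hN : 1 ≤ N) (hNL : N < L) {y : Fin N → ℤ} (hy : IsConfig L y) {a : ℤ}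
    (ha : y ⟨0, hN⟩ < a) :
    ∃ P : Polynomial ℂ, (∀ z, Subcritical N L z → betheCoeff N L 1 a 0 y z = P.eval (z ^ L)⁻¹) ∧
      P.eval 0 = 0 := by
  have hex : ∀ i j : Fin N, ∃ P : Polynomial ℂ, (∀ z, Subcritical N L z →
      residueSum N L (j - i - (1 : ℕ) + N) (y j - j - a + (1 : ℕ) + L - N - 1) z =
        P.eval (z ^ L)⁻¹) ∧ (j = ⟨0, hN⟩ → P.eval 0 = 0) := by
    intro i j
    have h := hy.2 ⟨0, hN⟩ j
    obtain ⟨m, hm⟩ := Int.eq_ofNat_of_zero_le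
      (show 0 ≤ ((j : ℕ) : ℤ) - (i : ℕ) - (1 : ℕ) + N by have := i.2; omega)
    rw [hm]
    obtain ⟨P, hP, hP0⟩ := residueSum_inv_polynomial hN hNL m
      (y j - (j : ℕ) - a + (1 : ℕ) + L - N - 1) (by omega)
    refine ⟨P, hP, ?_⟩
    rintro rfl
    rw [hP0 (by omega), if_neg (by omega)]
  choose P hP hP0 using hex
  refine ⟨(Matrix.of P).det, fun z hz => ?_, ?_⟩
  · rw [betheCoeff_zero hN hNL hz, eval_det, Nat.sub_self, pow_zero, one_mul]
    congr 2
    ext i j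
    exact hP i j z hz
  · rw [eval_det]
    exact Matrix.det_eq_zero_of_column_eq_zero ⟨0, hN⟩ fun i => hP0 i _ rfl

lemma contourIntegral_congr {F G : ℂ → ℂ} {γ : ℝ → ℂ}
    (h : ∀ s ∈ Set.Icc (0 : ℝ) 1, F (γ s) = G (γ s)) :
    contourIntegral F γ = contourIntegral G γ := by
  refine intervalIntegral.integral_congr fun s hs => ?_
  rw [Set.uIcc_of_le zero_le_one] at hs
  simp only [contourIntegrand, h s hs]

/-- At time `0` the contour integral is the indicator function of `y_k ≥ a`. -/
lemma contourIntegral_betheCoeff_zero (hN : 1 ≤ N) (hNL : N < L) {γ : ℝ → ℂ}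
    (hγ : IsSimpleClosedContour γ) (hccw : IsCounterclockwise γ) (h0 : (0 : ℂ) ∈ inside γ)
    (hsub : ∀ s ∈ Set.Icc (0 : ℝ) 1, Subcritical N L (γ s)) (a : ℤ) (k : ℕ) (hk : k < N)
    {y : Fin N → ℤ} (hy : IsConfig L y) :
    contourIntegral (fun z => betheCoeff N L (k + 1) a 0 y z / (2 * Real.pi * Complex.I * z)) γ =
      if a ≤ y ⟨k, hk⟩ then 1 else 0 := by
  induction k generalizing y with
  | zero =>
    have hL : (L : ℤ) ≠ 0 := by omega
    split_ifs with ha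
    · obtain ⟨P, hP, hP0⟩ := betheCoeff_of_le hN hNL hy ha
      rw [← hP0, ← contourIntegral_polynomial hγ hccw h0 hL P]
      refine contourIntegral_congr fun s hs => ?_
      rw [hP _ (hsub s hs), zpow_natCast]
    · obtain ⟨P, hP, hP0⟩ := betheCoeff_of_lt hN hNL hy (not_le.1 ha)
      rw [← hP0, ← contourIntegral_polynomial hγ hccw h0 (neg_ne_zero.2 hL) P]
      refine contourIntegral_congr fun s hs => ?_
      rw [hP _ (hsub s hs), zpow_neg, zpow_natCast]
  | succ k ih =>
    have h := ih (by omega) hy.rotate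
    have e : rotateConfig L y ⟨k, by omega⟩ = y ⟨k + 1, hk⟩ := dif_pos hk
    rw [e] at h
    rw [← h]
    refine contourIntegral_congr fun s hs => ?_
    rw [betheCoeff_rotateConfig hN hNL (hsub s hs) (by omega)]

/-! ### From the martingale problem to the exponential series of the generator -/

section Dynkin

lemma abs_generator_le {f : Config N L → ℝ} {C : ℝ} (hf : ∀ x, |f x| ≤ C) (x : Config N L) :
    |generator f x| ≤ 2 * N * C := by
  have hC : 0 ≤ C := (abs_nonneg _).trans (hf x)
  rw [generator]
  refine (Finset.abs_sum_le_sum_abs _ _).trans ?_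
  refine (Finset.sum_le_sum (g := fun _ => 2 * C) fun i _ => ?_).trans ?_
  · split_ifs with h
    · refine (abs_sub _ _).trans ?_
      linarith [hf ⟨_, h⟩, hf x]
    · rw [abs_zero]; linarith
  · rw [Finset.sum_const, Finset.card_univ, Fintype.card_fin, nsmul_eq_mul]
    exact le_of_eq (by ring)

variable {Ω : Type*} {mΩ : MeasurableSpace Ω} {μ : Measure Ω} {ℱ : Filtration ℝ≥0 mΩ}
  {X : ℝ≥0 → Ω → Config N L} {y : Config N L}

lemma IsTASEP.measurable (hX : IsTASEP μ ℱ X y) (t : ℝ≥0) : Measurable (X t) :=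
  (hX.adapted t).mono (ℱ.le t) le_rfl

/-- Right continuous paths make the process jointly measurable: it is the limit of its values at
the times `(⌊(n + 1) s⌋ + 1) / (n + 1)`, which decrease to `s`. -/
lemma IsTASEP.measurable_uncurry (hX : IsTASEP μ ℱ X y) (g : Config N L → ℝ) :
    Measurable fun p : ℝ × Ω => g (X p.1.toNNReal p.2) := by
  have hg : ∀ t, Measurable fun ω => g (X t ω) := fun t => measurable_from_top.comp (hX.measurable t)
  set τ : ℕ → ℝ≥0 → ℝ≥0 := fun n s => ((⌊((n : ℝ≥0) + 1) * s⌋₊ : ℝ≥0) + 1) / (n + 1) with hτ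
  have hpos : ∀ n : ℕ, (0 : ℝ≥0) < n + 1 := fun n => by positivity
  have hτ_gt : ∀ n s, s < τ n s := by
    intro n s
    rw [hτ, lt_div_iff₀ (hpos n), mul_comm]
    exact Nat.lt_floor_add_one _
  have hτ_le : ∀ n s, τ n s ≤ s + 1 / (n + 1) := by
    intro n s
    rw [hτ, div_le_iff₀ (hpos n), add_mul s, div_mul_cancel₀ _ (hpos n).ne', mul_comm s]
    gcongr
    exact Nat.floor_le zero_le
  have hτ_lim : ∀ s, Tendsto (fun n => τ n s) atTop (𝓝[>] s) := by
    intro s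
    refine tendsto_nhdsWithin_iff.2 ⟨?_, Eventually.of_forall fun n => hτ_gt n s⟩
    have h1 : Tendsto (fun n : ℕ => s + 1 / ((n : ℝ≥0) + 1)) atTop (𝓝 (s + 0)) :=
      tendsto_const_nhds.add tendsto_one_div_add_atTop_nhds_zero_nat
    rw [add_zero] at h1
    exact tendsto_of_tendsto_of_tendsto_of_le_of_le tendsto_const_nhds h1
      (fun n => (hτ_gt n s).le) fun n => hτ_le n s
  refine measurable_of_tendsto_metrizable
    (f := fun n p => g (X (τ n p.1.toNNReal) p.2)) (fun n => ?_) ?_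
  · have h1 : Measurable fun q : ℕ × Ω => g (X (((q.1 : ℝ≥0) + 1) / (n + 1)) q.2) :=
      measurable_from_prod_countable_right fun m => hg (((m : ℝ≥0) + 1) / (n + 1))
    have h2 : Measurable fun p : ℝ × Ω => (⌊((n : ℝ≥0) + 1) * p.1.toNNReal⌋₊, p.2) := by
      fun_prop
    have h3 := h1.comp h2
    simp only [Function.comp_def] at h3
    simp only [hτ]
    exact h3
  · rw [tendsto_pi_nhds]
    intro p
    refine tendsto_nhds_of_eventually_eq ?_
    filter_upwards [(hτ_lim p.1.toNNReal).eventually (hX.right_continuous p.2 p.1.toNNReal)]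
      with n hn
    rw [hn]

variable [IsProbabilityMeasure μ]

lemma IsTASEP.integrable_comp (hX : IsTASEP μ ℱ X y) {f : Config N L → ℝ} {C : ℝ}
    (hf : ∀ x, |f x| ≤ C) (t : ℝ≥0) : Integrable (fun ω => f (X t ω)) μ :=
  Integrable.of_bound (measurable_from_top.comp (hX.measurable t)).aestronglyMeasurable C
    (ae_of_all _ fun _ => hf _)

lemma IsTASEP.intervalIntegrable_expectation (hX : IsTASEP μ ℱ X y) {f : Config N L → ℝ} {C : ℝ}
    (hf : ∀ x, |f x| ≤ C) (a b : ℝ) :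
    IntervalIntegrable (fun s : ℝ => ∫ ω, f (X s.toNNReal ω) ∂μ) volume a b := by
  have hm := StronglyMeasurable.integral_prod_right (ν := μ)
    (f := fun (s : ℝ) ω => f (X s.toNNReal ω)) (hX.measurable_uncurry f).stronglyMeasurable
  refine (intervalIntegrable_const (c := C)).mono_fun hm.aestronglyMeasurable
    (ae_of_all _ fun s => ?_)
  refine (norm_integral_le_of_norm_le_const (ae_of_all μ fun ω => hf _)).trans ?_
  simp only [probReal_univ, mul_one]
  exact le_abs_self C

/-- Dynkin's formula. -/
lemma IsTASEP.expectation_eq (hX : IsTASEP μ ℱ X y) {f : Config N L → ℝ} {C : ℝ}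
    (hf : ∀ x, |f x| ≤ C) (t : ℝ≥0) :
    ∫ ω, f (X t ω) ∂μ =
      f y + ∫ s in (0 : ℝ)..t, ∫ ω, generator f (X s.toNNReal ω) ∂μ := by
  have hM := hX.martingale f ⟨C, hf⟩
  have h0 := hM.setIntegral_eq (i := 0) (j := t) zero_le MeasurableSet.univ
  simp only [Measure.restrict_univ, NNReal.coe_zero, intervalIntegral.integral_same, sub_self,
    integral_zero] at h0
  have hint1 := hX.integrable_comp hf t
  have hint0 := hX.integrable_comp hf 0
  have hintM := hM.integrable t
  have hint2 : Integrable (fun ω => ∫ s in (0 : ℝ)..t, generator f (X s.toNNReal ω)) μ := by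
    have h := (hint1.sub hint0).sub hintM
    refine h.congr (ae_of_all _ fun ω => ?_)
    simp
  have hint10 : Integrable (fun ω => f (X t ω) - f (X 0 ω)) μ := hint1.sub hint0
  rw [integral_sub hint10 hint2, integral_sub hint1 hint0] at h0
  have hy : ∫ ω, f (X 0 ω) ∂μ = f y := by
    rw [integral_congr_ae (g := fun _ => f y) (hX.initial.mono fun ω h => by rw [h])]
    simp
  have hswap : ∫ ω, (∫ s in (0 : ℝ)..t, generator f (X s.toNNReal ω)) ∂μ =
      ∫ s in (0 : ℝ)..t, ∫ ω, generator f (X s.toNNReal ω) ∂μ := by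
    simp only [intervalIntegral.integral_of_le t.coe_nonneg]
    refine integral_integral_swap (f := fun ω (s : ℝ) => generator f (X s.toNNReal ω)) ?_
    refine Integrable.of_bound (C := 2 * N * C) ?_ (ae_of_all _ fun p => abs_generator_le hf _)
    exact ((hX.measurable_uncurry (generator f)).comp measurable_swap).aestronglyMeasurable
  rw [hy, hswap] at h0
  linarith

/-- Iterating Dynkin's formula gives the Taylor expansion of `E f(X_t)`. -/
lemma IsTASEP.abs_expectation_sub_le (hX : IsTASEP μ ℱ X y) (M : ℕ) {f : Config N L → ℝ} {C : ℝ}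
    (hf : ∀ x, |f x| ≤ C) (t : ℝ≥0) :
    |∫ ω, f (X t ω) ∂μ - ∑ n ∈ Finset.range M, (t : ℝ) ^ n / n.factorial * (generator^[n] f) y| ≤
      (2 * N) ^ M * C * ((t : ℝ) ^ M / M.factorial) := by
  induction M generalizing f C t with
  | zero =>
    simp only [Finset.range_zero, Finset.sum_empty, sub_zero, pow_zero, one_mul,
      Nat.factorial_zero, Nat.cast_one, div_one, mul_one]
    refine (norm_integral_le_of_norm_le_const (f := fun ω => f (X t ω))
      (ae_of_all μ fun ω => hf _)).trans ?_
    simp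
  | succ M ih =>
    have hint := hX.intervalIntegrable_expectation (abs_generator_le hf) 0 t
    have hpow : ∀ n : ℕ, ∫ s in (0 : ℝ)..t, s ^ n / n.factorial =
        (t : ℝ) ^ (n + 1) / (n + 1).factorial := by
      intro n
      rw [intervalIntegral.integral_div, integral_pow, Nat.factorial_succ]
      push_cast
      rw [zero_pow (by omega), sub_zero, div_div]
    have hsum : ∑ n ∈ Finset.range M, (t : ℝ) ^ (n + 1) / (n + 1).factorial *
          (generator^[n + 1] f) y =
        ∫ s in (0 : ℝ)..t, ∑ n ∈ Finset.range M, s ^ n / n.factorial *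
          (generator^[n] (generator f)) y := by
      rw [intervalIntegral.integral_finsetSum fun n _ => Continuous.intervalIntegrable (by fun_prop) _ _]
      refine Finset.sum_congr rfl fun n _ => ?_
      rw [intervalIntegral.integral_mul_const, hpow, Function.iterate_succ_apply]
    rw [hX.expectation_eq hf, Finset.sum_range_succ', hsum]
    simp only [pow_zero, Nat.factorial_zero, Nat.cast_one, div_one, one_mul,
      Function.iterate_zero, id]
    rw [add_comm (f y), add_sub_add_right_eq_sub, ← intervalIntegral.integral_sub hint
      (Continuous.intervalIntegrable (by fun_prop) _ _), ← Real.norm_eq_abs]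
    refine (intervalIntegral.norm_integral_le_of_norm_le t.coe_nonneg
      (g := fun s => (2 * N) ^ M * (2 * N * C) * (s ^ M / M.factorial))
      (ae_of_all _ fun s hs => ?_) (Continuous.intervalIntegrable (by fun_prop) _ _)).trans ?_
    · have h := ih (abs_generator_le hf) s.toNNReal
      rwa [Real.coe_toNNReal s hs.1.le] at h
    · rw [intervalIntegral.integral_const_mul, hpow]
      exact le_of_eq (by ring)

/-- `E f(X_t) = ∑ t^n / n! (𝓛^n f)(y)`. -/
lemma IsTASEP.tendsto_expectation (hX : IsTASEP μ ℱ X y) {f : Config N L → ℝ} {C : ℝ}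
    (hf : ∀ x, |f x| ≤ C) (t : ℝ≥0) :
    Tendsto (fun M => ∑ n ∈ Finset.range M, (t : ℝ) ^ n / n.factorial * (generator^[n] f) y) atTop
      (𝓝 (∫ ω, f (X t ω) ∂μ)) := by
  rw [tendsto_iff_dist_tendsto_zero]
  refine squeeze_zero (fun _ => dist_nonneg) (fun M => ?_)
    (g := fun M : ℕ => C * ((2 * N * t : ℝ) ^ M / M.factorial)) ?_
  · rw [dist_comm, Real.dist_eq]
    refine (hX.abs_expectation_sub_le M hf t).trans (le_of_eq ?_)
    rw [mul_pow (2 * (N : ℝ))]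
    ring
  · have := (FloorSemiring.tendsto_pow_div_factorial_atTop (2 * N * t : ℝ)).const_mul C
    rwa [mul_zero] at this

end Dynkin

/-! ### The Fredholm determinant for the step initial condition -/

/-- The Lagrange basis polynomial of the right root `v`, evaluated at `u`. -/
def lagrangeCoeff (N L : ℕ) (z u v : ℂ) : ℂ :=
  (rightPoly N L z).eval u / ((u - v) * (rightPoly N L z).derivative.eval v)

lemma rightPoly_eq_nodal (N L : ℕ) (z : ℂ) :
    rightPoly N L z = Lagrange.nodal (rightRoots N L z) id := rfl

/-- Lagrange interpolation of monomials at the `N` right roots. -/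
lemma sum_lagrangeCoeff_mul_pow (hN : 1 ≤ N) (hNL : N < L) (hz : Subcritical N L z) {u : ℂ}
    (hu : u ∈ leftRoots N L z) {n : ℕ} (hn : n < N) :
    ∑ v ∈ rightRoots N L z, lagrangeCoeff N L z u v * v ^ n = u ^ n := by
  have hdeg : (Polynomial.X ^ n : Polynomial ℂ).degree < (rightRoots N L z).card := by
    rw [Polynomial.degree_X_pow, card_rightRoots hN hNL hz]
    exact_mod_cast hn
  have h := congrArg (Polynomial.eval u) (Lagrange.eq_interpolate (Set.injOn_id _) hdeg (v := id))
  rw [Lagrange.eval_interpolate_not_at_node (v := id) _ fun v hv => root_ne_left_right hu hv] at h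
  simp only [Polynomial.eval_pow, Polynomial.eval_X, id] at h
  rw [h, Finset.mul_sum]
  refine Finset.sum_congr rfl fun v hv => ?_
  have h1 := Lagrange.nodalWeight_eq_eval_derivative_nodal (v := (id : ℂ → ℂ)) hv
  rw [h1, lagrangeCoeff, rightPoly_eq_nodal, id]
  rw [div_eq_mul_inv, mul_inv]
  ring

lemma mem_betheRoots_of_left {u : ℂ} (hu : u ∈ leftRoots N L z) : u ∈ betheRoots N L z :=
  (Finset.mem_filter.1 hu).1

lemma mem_betheRoots_of_right {u : ℂ} (hu : u ∈ rightRoots N L z) : u ∈ betheRoots N L z :=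
  (Finset.mem_filter.1 hu).1

lemma rightPoly_derivative_ne_zero {v : ℂ} (hv : v ∈ rightRoots N L z) :
    (rightPoly N L z).derivative.eval v ≠ 0 := by
  have h1 := Lagrange.nodalWeight_eq_eval_derivative_nodal (v := (id : ℂ → ℂ)) hv
  have h2 := Lagrange.nodalWeight_ne_zero (Set.injOn_id _) hv
  intro h
  rw [h1, id, ← rightPoly_eq_nodal, h, inv_zero] at h2
  exact h2 rfl

lemma rightPoly_eval_ne_zero {u : ℂ} (hu : u ∈ leftRoots N L z) :
    (rightPoly N L z).eval u ≠ 0 :=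
  Lagrange.eval_nodal_not_at_node fun _ hv => root_ne_left_right hu hv

/-- A sum of rank one matrices over the Bethe roots factors through its part over the right roots:
the rows and columns belonging to a left root are combinations of those of the right roots. The
quotient of the two determinants is a determinant over the left roots, by `det (1 + XY) =
det (1 + YX)`. -/
lemma det_sum_eq_mul_det (hN : 1 ≤ N) (hNL : N < L) (hz : Subcritical N L z) (φ : ℂ → ℂ)
    (hφ : ∀ w ∈ rightRoots N L z, φ w ≠ 0) (e : Fin N ≃ rightRoots N L z) :
    (Matrix.of fun i j : Fin N =>
        ∑ w ∈ betheRoots N L z, w ^ (-(i : ℤ)) * φ w * w ^ (j : ℤ)).det =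
      (Matrix.of fun i l : Fin N => (e l : ℂ) ^ (-(i : ℤ))).det * (∏ v ∈ rightRoots N L z, φ v) *
        (Matrix.of fun l j : Fin N => (e l : ℂ) ^ (j : ℤ)).det *
      (1 + Matrix.of fun u u' : leftRoots N L z => φ u * ∑ v ∈ rightRoots N L z,
        lagrangeCoeff N L z u v * (φ v)⁻¹ *
          ((u' : ℂ) / v) ^ (1 - (N : ℤ)) * lagrangeCoeff N L z u' v).det := by
  have h0r : ∀ v : rightRoots N L z, (v : ℂ) ≠ 0 := fun v =>
    root_ne_zero hN hNL hz (mem_betheRoots_of_right v.2)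
  have h0l : ∀ v : leftRoots N L z, (v : ℂ) ≠ 0 := fun v =>
    root_ne_zero hN hNL hz (mem_betheRoots_of_left v.2)
  set V₁ : Matrix (Fin N) (rightRoots N L z) ℂ := Matrix.of fun i v => (v : ℂ) ^ (-(i : ℤ)) with hV₁
  set V₂ : Matrix (rightRoots N L z) (Fin N) ℂ := Matrix.of fun v j => (v : ℂ) ^ (j : ℤ) with hV₂
  set D : Matrix (rightRoots N L z) (rightRoots N L z) ℂ :=
    Matrix.diagonal fun v => φ v with hD
  set D' : Matrix (rightRoots N L z) (rightRoots N L z) ℂ :=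
    Matrix.diagonal fun v => (φ v)⁻¹ with hD'
  set Λ : Matrix (leftRoots N L z) (rightRoots N L z) ℂ :=
    Matrix.of fun u v => lagrangeCoeff N L z u v with hΛ
  set Λ' : Matrix (rightRoots N L z) (leftRoots N L z) ℂ :=
    Matrix.of fun v u => ((u : ℂ) / v) ^ (1 - (N : ℤ)) * lagrangeCoeff N L z u v with hΛ'
  set E : Matrix (leftRoots N L z) (leftRoots N L z) ℂ := Matrix.diagonal fun u => φ u with hE
  have hDD : D * D' = 1 := by
    rw [hD, hD', Matrix.diagonal_mul_diagonal, ← Matrix.diagonal_one]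
    congr 1
    funext v
    exact mul_inv_cancel₀ (hφ v v.2)
  have hcol : ∀ (u : leftRoots N L z) (j : Fin N), (Λ * V₂) u j = (u : ℂ) ^ (j : ℤ) := by
    intro u j
    rw [Matrix.mul_apply, hΛ, hV₂]
    simp only [Matrix.of_apply, zpow_natCast]
    rw [← sum_lagrangeCoeff_mul_pow hN hNL hz u.2 j.2, ← Finset.sum_coe_sort (rightRoots N L z)]
  have hrow : ∀ (i : Fin N) (u : leftRoots N L z), (V₁ * Λ') i u = (u : ℂ) ^ (-(i : ℤ)) := by
    intro i u
    rw [Matrix.mul_apply, hΛ', hV₁]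
    simp only [Matrix.of_apply]
    have h := sum_lagrangeCoeff_mul_pow hN hNL hz u.2 (n := N - 1 - i) (by have := i.2; omega)
    have hexp : ((N - 1 - i : ℕ) : ℤ) = -(i : ℤ) - (1 - N) := by have := i.2; omega
    have hu : (u : ℂ) ^ (-(i : ℤ)) = (u : ℂ) ^ (1 - (N : ℤ)) * (u : ℂ) ^ (N - 1 - i : ℕ) := by
      rw [← zpow_natCast, ← zpow_add₀ (h0l u), hexp]; congr 1; ring
    rw [hu, ← h, Finset.mul_sum, ← Finset.sum_coe_sort (rightRoots N L z)]
    refine Finset.sum_congr rfl fun v _ => ?_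
    have hv : (v : ℂ) ^ (-(i : ℤ)) = (v : ℂ) ^ (1 - (N : ℤ)) * (v : ℂ) ^ (N - 1 - i : ℕ) := by
      rw [← zpow_natCast, ← zpow_add₀ (h0r v), hexp]; congr 1; ring
    rw [hv, div_zpow]
    have := zpow_ne_zero (1 - (N : ℤ)) (h0r v)
    field_simp
  have hfac : (Matrix.of fun i j : Fin N =>
      ∑ w ∈ betheRoots N L z, w ^ (-(i : ℤ)) * φ w * w ^ (j : ℤ)) =
      V₁ * (D * (1 + D' * Λ' * (E * Λ))) * V₂ := by
    have e1 : V₁ * (D * (1 + D' * Λ' * (E * Λ))) * V₂ =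
        V₁ * D * V₂ + (V₁ * Λ') * E * (Λ * V₂) := by
      have : D * (1 + D' * Λ' * (E * Λ)) = D + Λ' * E * Λ := by
        rw [Matrix.mul_add, Matrix.mul_one, Matrix.mul_assoc D', ← Matrix.mul_assoc D,
          hDD, Matrix.one_mul, Matrix.mul_assoc]
      rw [this]
      simp only [Matrix.mul_add, Matrix.add_mul, Matrix.mul_assoc]
    rw [e1]
    ext i j
    rw [Matrix.add_apply, Matrix.mul_apply, Matrix.mul_apply, Matrix.of_apply,
      betheRoots_eq_union hN hNL hz, Finset.sum_union disjoint_left_right, add_comm,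
      ← Finset.sum_coe_sort (rightRoots N L z), ← Finset.sum_coe_sort (leftRoots N L z)]
    congr 1
    · refine Finset.sum_congr rfl fun v _ => ?_
      rw [hD, Matrix.mul_diagonal]
      rfl
    · refine Finset.sum_congr rfl fun u _ => ?_
      rw [hE, Matrix.mul_diagonal, hcol, hrow]
  have hdet : (V₁ * (D * (1 + D' * Λ' * (E * Λ))) * V₂).det =
      (V₁.submatrix id e).det * (D * (1 + D' * Λ' * (E * Λ))).det * (V₂.submatrix e id).det := by
    rw [← Matrix.det_submatrix_equiv_self e (D * (1 + D' * Λ' * (E * Λ))), ← Matrix.det_mul,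
      ← Matrix.det_mul, Matrix.submatrix_mul_equiv, Matrix.submatrix_mul_equiv]
    rfl
  rw [hfac, hdet, Matrix.det_mul, Matrix.det_one_add_mul_comm, hD, Matrix.det_diagonal,
    Finset.prod_coe_sort (rightRoots N L z) φ]
  have hK : E * Λ * (D' * Λ') = Matrix.of fun u u' : leftRoots N L z =>
      φ u * ∑ v ∈ rightRoots N L z, lagrangeCoeff N L z u v * (φ v)⁻¹ *
          ((u' : ℂ) / v) ^ (1 - (N : ℤ)) * lagrangeCoeff N L z u' v := by
    ext u u'
    rw [Matrix.mul_assoc, hE, Matrix.diagonal_mul, Matrix.mul_apply, Matrix.of_apply,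
      ← Finset.sum_coe_sort (rightRoots N L z)]
    congr 1
    refine Finset.sum_congr rfl fun v _ => ?_
    rw [hD', Matrix.diagonal_mul, hΛ, hΛ']
    simp only [Matrix.of_apply]
    ring
  rw [hK]
  have e1 : V₁.submatrix id e = Matrix.of fun i l : Fin N => (e l : ℂ) ^ (-(i : ℤ)) := rfl
  have e2 : V₂.submatrix e id = Matrix.of fun l j : Fin N => (e l : ℂ) ^ (j : ℤ) := rfl
  rw [e1, e2]
  ring

/-- The product of the two Vandermonde determinants at the right roots. -/
lemma det_vandermonde_mul (hN : 1 ≤ N) (hNL : N < L) (hz : Subcritical N L z)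
    (e : Fin N ≃ rightRoots N L z) :
    (Matrix.of fun i l : Fin N => (e l : ℂ) ^ (-(i : ℤ))).det *
      (Matrix.of fun l j : Fin N => (e l : ℂ) ^ (j : ℤ)).det =
      ∏ v ∈ rightRoots N L z, v ^ (1 - (N : ℤ)) * (rightPoly N L z).derivative.eval v := by
  set x : Fin N → ℂ := fun l => e l with hx
  have hx0 : ∀ l, x l ≠ 0 := fun l => root_ne_zero hN hNL hz (mem_betheRoots_of_right (e l).2)
  have h2 : (Matrix.of fun l j : Fin N => (e l : ℂ) ^ (j : ℤ)) = Matrix.vandermonde x := by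
    ext l j; simp [Matrix.vandermonde_apply, hx]
  have h1 : (Matrix.of fun i l : Fin N => (e l : ℂ) ^ (-(i : ℤ))).det =
      (∏ l, x l ^ (1 - (N : ℤ))) * (Matrix.projVandermonde 1 x).det := by
    rw [← Matrix.det_transpose, ← Matrix.det_mul_column]
    congr 1
    ext l i
    simp only [Matrix.transpose_apply, Matrix.of_apply, Matrix.projVandermonde_apply,
      Pi.one_apply, one_pow, one_mul, hx]
    rw [← zpow_natCast, ← zpow_add₀ (hx0 l), Fin.val_rev]
    congr 1
    have := i.2
    omega
  have h3 : ∀ l : Fin N, (rightPoly N L z).derivative.eval (x l) =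
      (∏ j ∈ Finset.Ioi l, (x l - x j)) * ∏ j ∈ Finset.Iio l, (x l - x j) := by
    intro l
    have hd := Lagrange.eval_nodal_derivative_eval_node_eq (v := (id : ℂ → ℂ)) (e l).2
    rw [id, ← rightPoly_eq_nodal, Lagrange.eval_nodal] at hd
    rw [hx, hd, ← Finset.prod_union (Finset.disjoint_left.2 fun j h h' =>
      (Finset.mem_Ioi.1 h).not_gt (Finset.mem_Iio.1 h'))]
    refine (Finset.prod_bij (fun j _ => (e j : ℂ)) ?_ ?_ ?_ ?_).symm
    · intro j hj
      refine Finset.mem_erase.2 ⟨fun h => ?_, (e j).2⟩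
      have hjl : j = l := e.injective (Subtype.ext h)
      subst hjl
      simp at hj
    · intro i _ j _ h
      exact e.injective (Subtype.ext h)
    · intro v hv
      have hv' := Finset.mem_erase.1 hv
      refine ⟨e.symm ⟨v, hv'.2⟩, ?_, by simp⟩
      rw [Finset.mem_union, Finset.mem_Ioi, Finset.mem_Iio]
      refine (lt_or_gt_of_ne fun h => hv'.1 ?_)
      rw [h]; simp
    · intro j _; rfl
  have h4 : ∏ v ∈ rightRoots N L z, v ^ (1 - (N : ℤ)) * (rightPoly N L z).derivative.eval v =
      ∏ l, x l ^ (1 - (N : ℤ)) * (rightPoly N L z).derivative.eval (x l) := by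
    rw [← Finset.prod_coe_sort (rightRoots N L z)]
    exact (Equiv.prod_comp e _).symm
  have h5 : ∏ l : Fin N, ∏ j ∈ Finset.Iio l, (x l - x j) =
      ∏ l : Fin N, ∏ j ∈ Finset.Ioi l, (x j - x l) :=
    Finset.prod_comm' (by simp)
  rw [h1, h2, h4, Finset.prod_mul_distrib, mul_assoc]
  congr 1
  simp_rw [h3]
  rw [Finset.prod_mul_distrib, h5, Matrix.det_projVandermonde, Matrix.det_vandermonde]
  simp

lemma bethePoly_eq_mul (hN : 1 ≤ N) (hNL : N < L) (hz : Subcritical N L z) :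
    bethePoly N L z = Lagrange.nodal (leftRoots N L z) id * rightPoly N L z := by
  rw [bethePoly_eq_nodal hN hNL hz, betheRoots_eq_union hN hNL hz, Lagrange.nodal_eq,
    Finset.prod_union disjoint_left_right]
  rfl

lemma bethePoly_derivative_eval_right (hN : 1 ≤ N) (hNL : N < L) (hz : Subcritical N L z) {v : ℂ}
    (hv : v ∈ rightRoots N L z) :
    (bethePoly N L z).derivative.eval v =
      (∏ u ∈ leftRoots N L z, (v - u)) * (rightPoly N L z).derivative.eval v := by
  have h0 : (rightPoly N L z).eval v = 0 := Lagrange.eval_nodal_at_node (v := id) hv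
  rw [bethePoly_eq_mul hN hNL hz, Polynomial.derivative_mul, Polynomial.eval_add,
    Polynomial.eval_mul, Polynomial.eval_mul, h0, mul_zero, zero_add, Lagrange.eval_nodal]
  rfl

/-- Vieta's formula for the product of the Bethe roots. -/
lemma prod_left_mul_prod_right (hN : 1 ≤ N) (hNL : N < L) (hz : Subcritical N L z) :
    (∏ u ∈ leftRoots N L z, (-u)) * ∏ v ∈ rightRoots N L z, v = (-1) ^ (N + 1) * z ^ L := by
  have h := congrArg (Polynomial.eval 0) (bethePoly_eq_mul hN hNL hz)
  rw [Polynomial.eval_mul, Lagrange.eval_nodal, rightPoly_eq_nodal, Lagrange.eval_nodal] at h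
  simp only [bethePoly, Polynomial.eval_sub, Polynomial.eval_mul, Polynomial.eval_pow,
    Polynomial.eval_X, Polynomial.eval_C, zero_pow (by omega : N ≠ 0), zero_mul, zero_sub, id] at h
  have h2 : ∏ v ∈ rightRoots N L z, (-v) = (-1) ^ N * ∏ v ∈ rightRoots N L z, v := by
    rw [Finset.prod_neg, card_rightRoots hN hNL hz]
  have h3 : ((-1 : ℂ) ^ N) * (-1) ^ N = 1 := by rw [← mul_pow]; norm_num
  rw [h2] at h
  linear_combination (-(-1 : ℂ) ^ N) * h - (∏ u ∈ leftRoots N L z, (-u)) *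
    (∏ v ∈ rightRoots N L z, v) * h3

/-- The one-particle weight for the step initial condition. -/
def stepWeight (N L k : ℕ) (t : ℝ) (a : ℤ) (w : ℂ) : ℂ :=
  w ^ (1 - (k : ℤ)) * (w + 1) ^ (-a - N + k + 1) * Complex.exp (t * w) / (L * (w + density N L))

lemma stepWeight_mul (hN : 1 ≤ N) (hNL : N < L) (hz : Subcritical N L z) (k : ℕ) (t : ℝ) (a : ℤ)
    {w : ℂ} (hw : w ∈ betheRoots N L z) :
    stepWeight N L k t a w * (L * w ^ (1 - (N : ℤ))) = weight N L k t a w := by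
  have h0 := root_ne_zero hN hNL hz hw
  have h2 := root_add_density_ne_zero hN hNL hz hw
  have hL : (L : ℂ) ≠ 0 := by exact_mod_cast (by omega : L ≠ 0)
  rw [stepWeight, weight, show -(N : ℤ) - k + 2 = (1 - k) + (1 - N) by ring, zpow_add₀ h0]
  field_simp

lemma stepWeight_ne_zero (hN : 1 ≤ N) (hNL : N < L) (hz : Subcritical N L z) (k : ℕ) (t : ℝ)
    (a : ℤ) {w : ℂ} (hw : w ∈ betheRoots N L z) : stepWeight N L k t a w ≠ 0 := by
  have h0 := root_ne_zero hN hNL hz hw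
  have h1 := root_add_one_ne_zero hNL hz hw
  have h2 := root_add_density_ne_zero hN hNL hz hw
  have hL : (L : ℂ) ≠ 0 := by exact_mod_cast (by omega : L ≠ 0)
  exact div_ne_zero (mul_ne_zero (mul_ne_zero (zpow_ne_zero _ h0) (zpow_ne_zero _ h1))
    (Complex.exp_ne_zero _)) (mul_ne_zero hL h2)

/-- Up to conjugation by a diagonal matrix the determinant over the left roots is that of
`1 + K`. -/
lemma det_left_eq_det_kernelK (hN : 1 ≤ N) (hNL : N < L) (hz : Subcritical N L z) (k : ℕ) (t : ℝ)
    (a : ℤ) :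
    (1 + Matrix.of fun u u' : leftRoots N L z => stepWeight N L k t a u *
      ∑ v ∈ rightRoots N L z, lagrangeCoeff N L z u v * (stepWeight N L k t a v)⁻¹ *
          ((u' : ℂ) / v) ^ (1 - (N : ℤ)) * lagrangeCoeff N L z u' v).det =
      (1 + kernelK N L k t a z).det := by
  set g : leftRoots N L z → ℂ := fun u =>
    (rightPoly N L z).eval (u : ℂ) * (u : ℂ) ^ (1 - (N : ℤ)) with hg
  have hg0 : ∀ u, g u ≠ 0 := fun u => mul_ne_zero (rightPoly_eval_ne_zero u.2)
    (zpow_ne_zero _ (root_ne_zero hN hNL hz (mem_betheRoots_of_left u.2)))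
  set B := Matrix.of fun u u' : leftRoots N L z => stepWeight N L k t a u *
      ∑ v ∈ rightRoots N L z, lagrangeCoeff N L z u v * (stepWeight N L k t a v)⁻¹ *
          ((u' : ℂ) / v) ^ (1 - (N : ℤ)) * lagrangeCoeff N L z u' v with hB
  have hL : (L : ℂ) ≠ 0 := by exact_mod_cast (by omega : L ≠ 0)
  have hentry : Matrix.diagonal g * B = kernelK N L k t a z * Matrix.diagonal g := by
    ext u u'
    rw [Matrix.diagonal_mul, Matrix.mul_diagonal, hB, kernelK, Matrix.of_apply, Matrix.of_apply,
      f₂Left, ← stepWeight_mul hN hNL hz k t a (mem_betheRoots_of_left u.2), Finset.mul_sum,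
      Finset.mul_sum, Finset.mul_sum, Finset.sum_mul]
    refine Finset.sum_congr rfl fun v hv => ?_
    rw [f₂Right, ← stepWeight_mul hN hNL hz k t a (mem_betheRoots_of_right hv), lagrangeCoeff,
      lagrangeCoeff, div_zpow, hg]
    have h1 := stepWeight_ne_zero hN hNL hz k t a (mem_betheRoots_of_right hv)
    have h2 := zpow_ne_zero (1 - (N : ℤ)) (root_ne_zero hN hNL hz (mem_betheRoots_of_right hv))
    have h3 := rightPoly_derivative_ne_zero hv
    have h4 := sub_ne_zero.2 (root_ne_left_right u.2 hv)
    have h5 := sub_ne_zero.2 (root_ne_left_right u'.2 hv)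
    field_simp
  have hmul : Matrix.diagonal g * (1 + B) = (1 + kernelK N L k t a z) * Matrix.diagonal g := by
    rw [Matrix.mul_add, Matrix.add_mul, hentry, Matrix.mul_one, Matrix.one_mul]
  have hdet := congrArg Matrix.det hmul
  rw [Matrix.det_mul, Matrix.det_mul, mul_comm] at hdet
  refine mul_right_cancel₀ ?_ hdet
  rw [Matrix.det_diagonal]
  exact Finset.prod_ne_zero_iff.2 fun u _ => hg0 u

/-- The part over the right roots is the prefactor: `L (v + ρ)` is expressed through
`q_z'(v) = q_right'(v) ∏_u (v - u)`, which cancels `q_right'(v)`, and the power of `z ^ L` is absorbed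
by Vieta's formula. -/
lemma prefactor_eq (hN : 1 ≤ N) (hNL : N < L) (hz : Subcritical N L z) {k : ℕ} (hk : 1 ≤ k)
    (t : ℝ) (a : ℤ) :
    ((-1) ^ (N + 1) * z ^ L) ^ (k - 1) *
      ((∏ v ∈ rightRoots N L z, v ^ (1 - (N : ℤ)) * (rightPoly N L z).derivative.eval v) *
        ∏ v ∈ rightRoots N L z, stepWeight N L k t a v) = prefactor N L k t a z := by
  have hterm : ∀ v ∈ rightRoots N L z,
      v ^ (1 - (N : ℤ)) * (rightPoly N L z).derivative.eval v * stepWeight N L k t a v =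
        (v ^ (k - 1))⁻¹ * ((v + 1) ^ (-a + L - 2 * N + k : ℤ) * Complex.exp (t * v)) *
          (∏ u ∈ leftRoots N L z, (v - u))⁻¹ := by
    intro v hv
    have hv' := mem_betheRoots_of_right hv
    have h0 := root_ne_zero hN hNL hz hv'
    have h1 := root_add_one_ne_zero hNL hz hv'
    have h2 := root_add_density_ne_zero hN hNL hz hv'
    have h3 := rightPoly_derivative_ne_zero hv
    have hL : (L : ℂ) ≠ 0 := by exact_mod_cast (by omega : L ≠ 0)
    have hd := bethePoly_derivative_eval_right hN hNL hz hv
    rw [bethePoly_derivative_eval hN hNL] at hd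
    have hp : ∏ u ∈ leftRoots N L z, (v - u) ≠ 0 :=
      Finset.prod_ne_zero_iff.2 fun u hu => sub_ne_zero.2 (root_ne_left_right hu hv).symm
    have e1 : v ^ (1 - (k : ℤ)) = (v ^ (k - 1))⁻¹ := by
      rw [← zpow_natCast, ← zpow_neg]; congr 1; omega
    have e2 : v ^ (1 - (N : ℤ)) = (v ^ (N - 1))⁻¹ := by
      rw [← zpow_natCast, ← zpow_neg]; congr 1; omega
    have e3 : (v + 1) ^ (-a + L - 2 * N + k : ℤ) =
        (v + 1) ^ (-a - N + k + 1) * (v + 1) ^ (L - N - 1) := by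
      rw [← zpow_natCast, ← zpow_add₀ h1]; congr 1; omega
    rw [stepWeight, e1, e2, e3]
    have h5 := pow_ne_zero (N - 1) h0
    have h6 := pow_ne_zero (k - 1) h0
    field_simp
    linear_combination -hd
  rw [← Finset.prod_mul_distrib, Finset.prod_congr rfl hterm, Finset.prod_mul_distrib,
    Finset.prod_mul_distrib, Finset.prod_inv_distrib, Finset.prod_inv_distrib, prefactor,
    ← prod_left_mul_prod_right hN hNL hz, Finset.prod_comm (s := leftRoots N L z),
    Finset.prod_pow, Finset.prod_pow, mul_pow]
  have hne : (∏ v ∈ rightRoots N L z, v) ^ (k - 1) ≠ 0 :=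
    pow_ne_zero _ (Finset.prod_ne_zero_iff.2 fun v hv =>
      root_ne_zero hN hNL hz (mem_betheRoots_of_right hv))
  generalize ∏ v ∈ rightRoots N L z,
    (v + 1) ^ (-a + L - 2 * N + k : ℤ) * Complex.exp (t * v) = Q
  field_simp

/-- For the step initial condition the Bethe determinant is the prefactor times the Fredholm
determinant. -/
lemma bethe_det_eq_fredholm (hN : 1 ≤ N) (hNL : N < L) (hz : Subcritical N L z) {k : ℕ}
    (hk : 1 ≤ k) (t : ℝ) (a : ℤ) :
    ((-1) ^ (N + 1) * z ^ L) ^ (k - 1) * (Matrix.of fun i j : Fin N => ∑ w ∈ betheRoots N L z,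
      rowFun N L k a i w * (colFun (stepConfig N L hNL).1 j w * Complex.exp (t * w))).det =
      prefactor N L k t a z * (1 + kernelK N L k t a z).det := by
  have e : Fin N ≃ rightRoots N L z :=
    (finCongr (card_rightRoots hN hNL hz).symm).trans (rightRoots N L z).equivFin.symm
  have hmat : (Matrix.of fun i j : Fin N => ∑ w ∈ betheRoots N L z,
      rowFun N L k a i w * (colFun (stepConfig N L hNL).1 j w * Complex.exp (t * w))) =
      Matrix.of fun i j : Fin N => ∑ w ∈ betheRoots N L z,
        w ^ (-(i : ℤ)) * stepWeight N L k t a w * w ^ (j : ℤ) := by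
    ext i j
    refine Finset.sum_congr rfl fun w hw => ?_
    have h0 := root_ne_zero hN hNL hz hw
    have h1 := root_add_one_ne_zero hNL hz hw
    have hy : (stepConfig N L hNL).1 j - j = -(N : ℤ) + 1 := by simp only [stepConfig]; ring
    rw [rowFun, colFun, stepWeight, hy,
      show -(i : ℤ) + 1 - k = -(i : ℤ) + (1 - k) by ring, zpow_add₀ h0,
      show -a - (N : ℤ) + k + 1 = (-a + k) + (-(N : ℤ) + 1) by ring, zpow_add₀ h1 (-a + k)]
    ring
  rw [hmat, det_sum_eq_mul_det hN hNL hz _ (fun w hw =>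
    stepWeight_ne_zero hN hNL hz k t a (mem_betheRoots_of_right hw)) e,
    det_left_eq_det_kernelK hN hNL hz, ← prefactor_eq hN hNL hz hk,
    ← det_vandermonde_mul hN hNL hz e]
  ring

/-! ### Summation of the exponential series under the contour integral -/

variable {γ : ℝ → ℂ}

/-- The Bethe roots that belong to points of the contour form a compact set, which avoids `0`, `-1`
and `-ρ`. -/
lemma rowFun_mul_colFun_bounded (hN : 1 ≤ N) (hNL : N < L) (hγ : IsSimpleClosedContour γ)
    (hsub : ∀ s ∈ Set.Icc (0 : ℝ) 1, Subcritical N L (γ s)) (k : ℕ) (a : ℤ) (y : Fin N → ℤ) :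
    ∃ B : ℝ, 0 ≤ B ∧ ∀ s ∈ Set.Icc (0 : ℝ) 1, ∀ w ∈ betheRoots N L (γ s),
      ‖w‖ ≤ 2 ∧ ∀ i j, ‖rowFun N L k a i w‖ * ‖colFun y j w‖ ≤ B := by
  set K : Set ℂ := {w | w ^ N * (w + 1) ^ (L - N) ∈ (fun s => γ s ^ L) '' Set.Icc 0 1} with hK
  have hmem : ∀ w ∈ K, ∃ s ∈ Set.Icc (0 : ℝ) 1, w ∈ betheRoots N L (γ s) := by
    rintro w ⟨s, hs, h⟩
    exact ⟨s, hs, (mem_betheRoots hNL).2 (sub_eq_zero.2 h.symm)⟩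
  have hle : ∀ w ∈ K, ‖w‖ ≤ 2 := by
    intro w hw
    obtain ⟨s, hs, hws⟩ := hmem w hw
    by_contra! h
    have h1 : 1 < ‖w‖ ^ N := one_lt_pow₀ (by linarith) (by omega)
    have h2 : 1 ≤ ‖w + 1‖ ^ (L - N) := by
      refine one_le_pow₀ ?_
      have := norm_sub_le (w + 1) 1
      rw [add_sub_cancel_right, norm_one] at this
      linarith
    have h3 : ‖γ s‖ ^ L ≤ 1 := pow_le_one₀ (norm_nonneg _)
      ((hsub s hs).2.le.trans (criticalRadius_le_one hN hNL))
    rw [← norm_pow, ← bethe_equation hNL hws, norm_mul, norm_pow, norm_pow] at h3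
    nlinarith
  have hcomp : IsCompact K := by
    have himg : IsCompact ((fun s => γ s ^ L) '' Set.Icc 0 1) :=
      isCompact_Icc.image_of_continuousOn (hγ.continuousOn.pow L)
    refine Metric.isCompact_of_isClosed_isBounded ?_
      (Metric.isBounded_closedBall.subset fun w hw => mem_closedBall_zero_iff.2 (hle w hw))
    exact himg.isClosed.preimage
      (by fun_prop : Continuous fun w : ℂ => w ^ N * (w + 1) ^ (L - N))
  have hL : (L : ℂ) ≠ 0 := by exact_mod_cast (by omega : L ≠ 0)
  have h0 : ∀ w ∈ K, w ≠ 0 := fun w hw => by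
    obtain ⟨s, hs, hws⟩ := hmem w hw; exact root_ne_zero hN hNL (hsub s hs) hws
  have h1 : ∀ w ∈ K, w + 1 ≠ 0 := fun w hw => by
    obtain ⟨s, hs, hws⟩ := hmem w hw; exact root_add_one_ne_zero hNL (hsub s hs) hws
  have h2 : ∀ w ∈ K, w + density N L ≠ 0 := fun w hw => by
    obtain ⟨s, hs, hws⟩ := hmem w hw; exact root_add_density_ne_zero hN hNL (hsub s hs) hws
  have hz0 : ∀ m : ℤ, ContinuousOn (fun w : ℂ => w ^ m) K := fun m =>
    continuousOn_id.zpow₀ m fun w hw => Or.inl (h0 w hw)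
  have hz1 : ∀ m : ℤ, ContinuousOn (fun w : ℂ => (w + 1) ^ m) K := fun m =>
    ContinuousOn.zpow₀ (by fun_prop) m fun w hw => Or.inl (h1 w hw)
  have hcont : ContinuousOn (fun w => ∑ i : Fin N, ∑ j : Fin N,
      ‖rowFun N L k a i w‖ * ‖colFun y j w‖) K := by
    refine continuousOn_finsetSum _ fun i _ => continuousOn_finsetSum _ fun j _ => ?_
    exact (((hz0 _).mul (hz1 _)).div (by fun_prop) fun w hw => mul_ne_zero hL (h2 w hw)).norm.mul
      ((hz0 _).mul (hz1 _)).norm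
  obtain ⟨B, hB⟩ := hcomp.exists_bound_of_continuousOn hcont
  refine ⟨max B 0, le_max_right _ _, fun s hs w hw => ?_⟩
  have hwK : w ∈ K := ⟨s, hs, (bethe_equation hNL hw).symm⟩
  refine ⟨hle w hwK, fun i j => ?_⟩
  refine le_trans ?_ (le_max_left _ _)
  refine le_trans ?_ ((le_abs_self _).trans (hB w hwK))
  refine le_trans ?_ (Finset.single_le_sum (f := fun i => ∑ j : Fin N,
      ‖rowFun N L k a i w‖ * ‖colFun y j w‖)
    (fun i _ => Finset.sum_nonneg fun j _ => by positivity) (Finset.mem_univ i))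
  exact Finset.single_le_sum (f := fun j : Fin N => ‖rowFun N L k a i w‖ * ‖colFun y j w‖)
    (fun j _ => by positivity) (Finset.mem_univ j)

lemma norm_betheCoeff_le (hN : 1 ≤ N) (hNL : N < L) (hγ : IsSimpleClosedContour γ)
    (hsub : ∀ s ∈ Set.Icc (0 : ℝ) 1, Subcritical N L (γ s)) (k : ℕ) (a : ℤ) (y : Fin N → ℤ) :
    ∃ B : ℝ, 0 ≤ B ∧ ∀ s ∈ Set.Icc (0 : ℝ) 1, ∀ n : ℕ,
      ‖betheCoeff N L k a n y (γ s)‖ ≤ B * (N * 2) ^ n := by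
  obtain ⟨B, hB0, hB⟩ := rowFun_mul_colFun_bounded hN hNL hγ hsub k a y
  refine ⟨L ^ N * (N.factorial * B ^ N), by positivity, fun s hs n => ?_⟩
  have h1 := norm_tupleSum_le (betheRoots N L (γ s)) (rowFun N L k a) n (colFun y)
    (card_betheRoots hN hNL (hsub s hs)).le (fun w hw => (hB s hs w hw).1)
    (fun i j w hw => (hB s hs w hw).2 i j) zero_le_two hB0
  have h2 : ‖((-1 : ℂ) ^ (N + 1) * γ s ^ L) ^ (k - 1)‖ ≤ 1 := by
    rw [norm_pow, norm_mul, norm_pow, norm_pow, norm_neg, norm_one, one_pow, one_mul]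
    exact pow_le_one₀ (by positivity) (pow_le_one₀ (norm_nonneg _)
      ((hsub s hs).2.le.trans (criticalRadius_le_one hN hNL)))
  rw [betheCoeff, norm_mul]
  refine (mul_le_of_le_one_left (norm_nonneg _) h2).trans (h1.trans (le_of_eq ?_))
  ring

lemma continuousOn_betheCoeff_div (hN : 1 ≤ N) (hNL : N < L) (k : ℕ) (a : ℤ) (n : ℕ)
    (y : Fin N → ℤ) :
    ContinuousOn (fun z => betheCoeff N L k a n y z / (2 * Real.pi * Complex.I * z))
      {z | Subcritical N L z} :=
  (continuousOn_betheCoeff hN hNL k a n y).div (by fun_prop) fun _ hz =>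
    mul_ne_zero Complex.two_pi_I_ne_zero (norm_pos_iff.1 hz.1)

/-- The contour integrals of the Bethe functions are the iterates of the generator, applied to the
indicator function of `x_k ≥ a`. -/
lemma generator_iterate_eq (hN : 1 ≤ N) (hNL : N < L) (hγ : IsSimpleClosedContour γ)
    (hccw : IsCounterclockwise γ) (h0 : (0 : ℂ) ∈ inside γ)
    (hsub : ∀ s ∈ Set.Icc (0 : ℝ) 1, Subcritical N L (γ s)) (a : ℤ) (k : ℕ) (hk : k < N)
    {f : Config N L → ℝ} (hf : ∀ x, f x = if a ≤ x.1 ⟨k, hk⟩ then 1 else 0) (n : ℕ)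
    (y : Config N L) :
    ((generator^[n] f y : ℝ) : ℂ) =
      contourIntegral
        (fun z => betheCoeff N L (k + 1) a n y.1 z / (2 * Real.pi * Complex.I * z)) γ := by
  induction n generalizing y with
  | zero =>
    rw [contourIntegral_betheCoeff_zero hN hNL hγ hccw h0 hsub a k hk y.2]
    rw [Function.iterate_zero, id, hf]
    split_ifs <;> simp
  | succ n ih =>
    have hint : ∀ y : Fin N → ℤ, IntervalIntegrable (contourIntegrand
        (fun z => betheCoeff N L (k + 1) a n y z / (2 * Real.pi * Complex.I * z)) γ) volume 0 1 :=
      fun y => hγ.intervalIntegrable (continuousOn_betheCoeff_div hN hNL _ a n y) hsub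
    have hrec : contourIntegral
        (fun z => betheCoeff N L (k + 1) a (n + 1) y.1 z / (2 * Real.pi * Complex.I * z)) γ =
        ∑ i, ∫ s in (0 : ℝ)..1, (contourIntegrand (fun z => betheCoeff N L (k + 1) a n
            (Function.update y.1 i (y.1 i + 1)) z / (2 * Real.pi * Complex.I * z)) γ s -
          contourIntegrand (fun z => betheCoeff N L (k + 1) a n y.1 z /
            (2 * Real.pi * Complex.I * z)) γ s) := by
      rw [← intervalIntegral.integral_finsetSum fun i _ => (hint _).sub (hint _)]
      refine intervalIntegral.integral_congr fun s hs => ?_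
      rw [Set.uIcc_of_le zero_le_one] at hs
      simp only [contourIntegrand]
      rw [betheCoeff_succ hNL (hsub s hs), Finset.sum_div, Finset.sum_mul]
      refine Finset.sum_congr rfl fun i _ => ?_
      ring
    rw [Function.iterate_succ_apply', generator, hrec, Complex.ofReal_sum]
    refine Finset.sum_congr rfl fun i _ => ?_
    split_ifs with h
    · have h' := ih ⟨_, h⟩
      rw [Complex.ofReal_sub, h', ih, intervalIntegral.integral_sub (hint _) (hint _)]
      rfl
    · rw [Complex.ofReal_zero, eq_comm]
      refine intervalIntegral.integral_zero_ae (ae_of_all _ fun s hs => ?_)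
      rw [Set.uIoc_of_le zero_le_one] at hs
      replace hs := Set.Ioc_subset_Icc_self hs
      simp only [contourIntegrand]
      rw [betheCoeff_blocked hN hNL (hsub s hs) _ a n y.2 i h, sub_self]

/-- Summing the exponential series under the contour integral gives the Fredholm determinant
formula. -/
lemma hasSum_contourIntegral (hN : 1 ≤ N) (hNL : N < L) (hγ : IsSimpleClosedContour γ)
    (hsub : ∀ s ∈ Set.Icc (0 : ℝ) 1, Subcritical N L (γ s)) (a : ℤ) {k : ℕ} (hk : 1 ≤ k)
    (t : ℝ) :
    IntervalIntegrable (contourIntegrand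
      (fun z => prefactor N L k t a z * (1 + kernelK N L k t a z).det /
        (2 * Real.pi * Complex.I * z)) γ) volume 0 1 ∧
    HasSum (fun n : ℕ => ((t ^ n / n.factorial : ℝ) : ℂ) * contourIntegral
        (fun z => betheCoeff N L k a n (stepConfig N L hNL).1 z /
          (2 * Real.pi * Complex.I * z)) γ)
      (contourIntegral (fun z => prefactor N L k t a z * (1 + kernelK N L k t a z).det /
        (2 * Real.pi * Complex.I * z)) γ) := by
  set y := (stepConfig N L hNL).1
  obtain ⟨B, hB0, hB⟩ := norm_betheCoeff_le hN hNL hγ hsub k a y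
  set F : ℕ → ℝ → ℂ := fun n s => ((t ^ n / n.factorial : ℝ) : ℂ) * contourIntegrand
    (fun z => betheCoeff N L k a n y z / (2 * Real.pi * Complex.I * z)) γ s with hF
  set G : ℝ → ℂ := contourIntegrand (fun z => (2 * Real.pi * Complex.I * z)⁻¹) γ with hG
  have hFint : ∀ n, IntervalIntegrable (F n) volume 0 1 := fun n =>
    (hγ.intervalIntegrable (continuousOn_betheCoeff_div hN hNL k a n y) hsub).const_mul _
  have hGint : IntervalIntegrable G volume 0 1 := by
    refine hγ.intervalIntegrable (U := {z | Subcritical N L z}) ?_ hsub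
    exact ContinuousOn.inv₀ (by fun_prop) fun _ hz =>
      mul_ne_zero Complex.two_pi_I_ne_zero (norm_pos_iff.1 hz.1)
  have hFm : ∀ n, AEStronglyMeasurable (F n) (volume.restrict (Set.uIoc 0 1)) := fun n =>
    (intervalIntegrable_iff.1 (hFint n)).aestronglyMeasurable
  set b : ℕ → ℝ → ℝ := fun n s => B * ((|t| * (N * 2)) ^ n / n.factorial) * ‖G s‖ with hb
  have hmem : ∀ s, s ∈ Set.uIoc (0 : ℝ) 1 → s ∈ Set.Icc (0 : ℝ) 1 := fun s hs => by
    rw [Set.uIoc_of_le zero_le_one] at hs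
    exact Set.Ioc_subset_Icc_self hs
  have hbound : ∀ n, ∀ s, s ∈ Set.uIoc (0 : ℝ) 1 → ‖F n s‖ ≤ b n s := by
    intro n s hs
    have h1 : F n s = ((t ^ n / n.factorial : ℝ) : ℂ) * betheCoeff N L k a n y (γ s) * G s := by
      simp only [hF, hG, contourIntegrand]; ring
    rw [h1, norm_mul, norm_mul, Complex.norm_real, norm_div, norm_pow, Real.norm_eq_abs,
      Real.norm_natCast, hb]
    have h2 := hB s (hmem s hs) n
    calc _ ≤ |t| ^ n / n.factorial * (B * (N * 2) ^ n) * ‖G s‖ := by gcongr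
      _ = _ := by rw [mul_pow]; ring
  have hsummable : ∀ s, Summable fun n => b n s := fun s =>
    ((Real.summable_pow_div_factorial _).mul_left B).mul_right _
  have hbint : IntervalIntegrable (fun s => ∑' n, b n s) volume 0 1 := by
    have : (fun s => ∑' n, b n s) =
        fun s => (∑' n : ℕ, B * ((|t| * (N * 2)) ^ n / n.factorial)) * ‖G s‖ := by
      funext s; exact tsum_mul_right
    rw [this]
    exact hGint.norm.const_mul _
  set f : ℝ → ℂ := contourIntegrand (fun z => prefactor N L k t a z *
    (1 + kernelK N L k t a z).det / (2 * Real.pi * Complex.I * z)) γ with hf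
  have hlim : ∀ s, s ∈ Set.uIoc (0 : ℝ) 1 → HasSum (fun n => F n s) (f s) := by
    intro s hs
    have hz := hsub s (hmem s hs)
    have h1 := ((hasSum_tupleSum (betheRoots N L (γ s)) (rowFun N L k a) (colFun y) t).mul_left
      (((-1) ^ (N + 1) * γ s ^ L) ^ (k - 1))).mul_right (G s)
    rw [bethe_det_eq_fredholm hN hNL hz hk] at h1
    have h2 : prefactor N L k t a (γ s) * (1 + kernelK N L k t a (γ s)).det * G s = f s := by
      simp only [hf, hG, contourIntegrand]; ring
    rw [h2] at h1
    convert! h1 using 2 with n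
    simp only [hF, hG, contourIntegrand, betheCoeff]
    push_cast
    ring
  have hfm : AEStronglyMeasurable f (volume.restrict (Set.uIoc 0 1)) := by
    refine aestronglyMeasurable_of_tendsto_ae atTop
      (f := fun m s => ∑ n ∈ Finset.range m, F n s) (fun m => ?_) ?_
    · exact Finset.aestronglyMeasurable_fun_sum _ fun n _ => hFm n
    · refine (ae_restrict_iff' measurableSet_uIoc).2 (ae_of_all _ fun s hs => ?_)
      exact (hlim s hs).tendsto_sum_nat
  refine ⟨hbint.mono_fun' hfm ?_, ?_⟩
  · refine (ae_restrict_iff' measurableSet_uIoc).2 (ae_of_all _ fun s hs => ?_)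
    beta_reduce
    rw [← (hlim s hs).tsum_eq]
    exact tsum_of_norm_bounded (hsummable s).hasSum fun n => hbound n s hs
  · have h := intervalIntegral.hasSum_integral_of_dominated_convergence b hFm
      (fun n => ae_of_all _ (hbound n)) (ae_of_all _ fun s _ => hsummable s) hbint
      (ae_of_all _ hlim)
    simp only [hF, intervalIntegral.integral_const_mul] at h
    exact h

end PeriodicTASEP
end

open PeriodicTASEP

theorem theorem7p2 (N L : ℕ) (hN : 1 ≤ N) (hNL : N < L)
    {Ω : Type*} {mΩ : MeasurableSpace Ω} (μ : Measure Ω) [IsProbabilityMeasure μ]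
    (ℱ : Filtration ℝ≥0 mΩ) (X : ℝ≥0 → Ω → Config N L)
    (hX : IsTASEP μ ℱ X (stepConfig N L hNL))
    (k : ℕ) (hk : 1 ≤ k) (hkN : k ≤ N) (t : ℝ≥0) (ht : 0 < t) (a : ℤ)
    (γ : ℝ → ℂ) (hγ : IsSimpleClosedContour γ) (hγ_ccw : IsCounterclockwise γ)
    (hγ_zero : (0 : ℂ) ∈ inside γ)
    (hγ_annulus : ∀ s ∈ Set.Icc (0 : ℝ) 1, 0 < ‖γ s‖ ∧ ‖γ s‖ < criticalRadius N L) :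
    IntervalIntegrable
        (contourIntegrand
          (fun z => prefactor N L k t a z * (1 + kernelK N L k t a z).det /
            (2 * Real.pi * Complex.I * z)) γ) volume 0 1 ∧
      ((μ.real {ω | a ≤ (X t ω).1 ⟨k - 1, by omega⟩} : ℝ) : ℂ) =
        contourIntegral
          (fun z => prefactor N L k t a z * (1 + kernelK N L k t a z).det /
            (2 * Real.pi * Complex.I * z)) γ := by
  obtain ⟨k, rfl⟩ : ∃ l, k = l + 1 := ⟨k - 1, by omega⟩
  have hkN' : k < N := by omega
  obtain ⟨hint, hsum⟩ := hasSum_contourIntegral hN hNL hγ hγ_annulus a hk (t : ℝ)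
  refine ⟨hint, ?_⟩
  set f : Config N L → ℝ := fun x => if a ≤ x.1 ⟨k, hkN'⟩ then (1 : ℝ) else 0 with hf
  have hfb : ∀ x, |f x| ≤ 1 := by
    intro x
    simp only [hf]
    split_ifs <;> simp
  have hprob : μ.real {ω | a ≤ (X t ω).1 ⟨k + 1 - 1, by omega⟩} = ∫ ω, f (X t ω) ∂μ := by
    have hmeas : MeasurableSet {ω | a ≤ (X t ω).1 ⟨k, hkN'⟩} :=
      hX.measurable t (MeasurableSpace.measurableSet_top (s := {x : Config N L | a ≤ x.1 ⟨k, hkN'⟩}))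
    have h := integral_indicator_one (μ := μ) hmeas
    refine h.symm.trans (integral_congr_ae (ae_of_all _ fun ω => ?_))
    simp [hf, Set.indicator_apply]
  rw [hprob]
  have h1 := (Complex.continuous_ofReal.tendsto _).comp (hX.tendsto_expectation hfb t)
  refine tendsto_nhds_unique h1 (hsum.tendsto_sum_nat.congr fun M => ?_)
  rw [Function.comp_apply, Complex.ofReal_sum]
  refine Finset.sum_congr rfl fun n _ => ?_
  rw [Complex.ofReal_mul, generator_iterate_eq hN hNL hγ hγ_ccw hγ_zero hγ_annulus a k hkN' (fun x => rfl) n]
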